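/- Let $d\ge 1$, $m\ge 0$, $\alpha^1,\dots,\alpha^m\in\mathbb R^d\setminus\{0\}$, $k_0\ge 0$, $k_1,\dots,k_m>0$, and let $$v(x)=|x|^{k_0}\prod_{j=1}^m|\langle\alpha^j,x\rangle|^{k_j},\qquad x\in\mathbb R^d .$$ For $\sigma=(\sigma_1,\dots,\sigma_d)$ with all $\sigma_i>0$, let $B^\sigma$ be the class of functions $f:\mathbb R^d\to\mathbb C$ that extend to an entire function on $\mathbb C^d$, again denoted by $f$, such that for every $\varepsilon>0$ there is a constant $c_\varepsilon$ with $$|f(z)|\le c_\varepsilon\, e^{(\sigma_1+\varepsilon)|z_1|+\dots+(\sigma_d+\varepsilon)|z_d|}\qquad\text{for all } z\in\mathbb C^d .$$ Let $a=(a_1,\dots,a_d)$ with $a_i>\sigma_i$ for all $i$, and let $\delta,L>0$ and $0<p<\infty$. Then there are constants $C_1,C_2>0$, depending only on $d,m,\alpha^1,\dots,\alpha^m,k_0,\dots,k_m,\sigma,a,\delta,L,p$, with the following property. Let $\lambda^{(n)}$, $n\in\mathbb Z^d$, be any sequence in $\mathbb R^d$ of the form $$\lambda^{(n)}=(\lambda_1(n_1),\lambda_2(n_1,n_2),\dots,\lambda_d(n_1,\dots,n_d)),$$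 where $\lambda_i(n_1,\dots,n_i)$ is increasing in $n_i$ for fixed $n_1,\dots,n_{i-1}$, such that for all $n\in\mathbb Z^d$, $i=1,\dots,d$ and $j=1,\dots,m$: - $\lambda_i(n_1,\dots,n_{i-1},n_i+1)-\lambda_i(n_1,\dots,n_{i-1},n_i)\ge\delta$, - $\left|\lambda_i(n_1,\dots,n_i)-\dfrac{\pi n_i}{a_i}\right|\le L$, - $|\lambda^{(n)}|\ge\delta$ and $|\langle\alpha^j,\lambda^{(n)}\rangle|\ge\delta$. Then for every $f\in B^\sigma$, $$\sum_{n\in\mathbb Z^d}v(\lambda^{(n)})|f(\lambda^{(n)})|^p\le C_1\int_{\mathbb R^d}|f(x)|^p v(x)\,dx ,\qquad \int_{\mathbb R^d}|f(x)|^p v(x)\,dx\le C_2\sum_{n\in\mathbb Z^d}v(\lambda^{(n)})|f(\lambda^{(n)})|^p ,$$ where both sides are understood in $[0,\infty]$; in particular, the sum and the integral are finite or infinite simultaneously. -/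

import Mathlib

open scoped NNReal ENNReal

/-- The power weight `v(x) = |x|^{k₀} ∏_j |⟨α^j, x⟩|^{k_j}` on `ℝ^d`. -/
noncomputable def powerWeight {d m : ℕ} (α : Fin m → EuclideanSpace ℝ (Fin d))
    (k₀ : ℝ) (k : Fin m → ℝ) (x : EuclideanSpace ℝ (Fin d)) : ℝ :=
  ‖x‖ ^ k₀ * ∏ j, |inner ℝ (α j) x| ^ k j

/-- The class `B^σ`: functions on `ℝ^d` that have an entire extension `F` to `ℂ^d` such that for
every `ε > 0` one has `|F(z)| ≤ c_ε exp(∑ (σ_i + ε)|z_i|)` on `ℂ^d`. -/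
def MemExpType {d : ℕ} (σ : Fin d → ℝ) (f : EuclideanSpace ℝ (Fin d) → ℂ) : Prop :=
  ∃ F : (Fin d → ℂ) → ℂ, Differentiable ℂ F ∧
    (∀ x : EuclideanSpace ℝ (Fin d), F (fun i => (x i : ℂ)) = f x) ∧
    ∀ ε : ℝ, 0 < ε → ∃ c : ℝ, ∀ z : Fin d → ℂ,
      ‖F z‖ ≤ c * Real.exp (∑ i, (σ i + ε) * ‖z i‖)

/-- Sequences of the form `λ(n) = (λ_1(n_1), λ_2(n_1,n_2), …, λ_d(n_1,…,n_d))`, where the `i`-th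
coordinate is increasing in `n_i` for fixed `n_1, …, n_{i-1}`. -/
structure IsTriangularSeq {d : ℕ} (lam : (Fin d → ℤ) → EuclideanSpace ℝ (Fin d)) : Prop where
  depends : ∀ (i : Fin d) (n n' : Fin d → ℤ), (∀ j ≤ i, n j = n' j) → lam n i = lam n' i
  increasing : ∀ (i : Fin d) (n n' : Fin d → ℤ), (∀ j < i, n j = n' j) → n i < n' i →
    lam n i < lam n' i

/-- The separation condition `Ω_sep[δ]`. -/
def IsSepSeq {d : ℕ} (δ : ℝ) (lam : (Fin d → ℤ) → EuclideanSpace ℝ (Fin d)) : Prop :=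
  ∀ (n : Fin d → ℤ) (i : Fin d), δ ≤ lam (Function.update n i (n i + 1)) i - lam n i

/-- The close-lattice condition `Ω_lat[a, L]`. -/
def IsNearLatticeSeq {d : ℕ} (a : Fin d → ℝ) (L : ℝ)
    (lam : (Fin d → ℤ) → EuclideanSpace ℝ (Fin d)) : Prop :=
  ∀ (n : Fin d → ℤ) (i : Fin d), |lam n i - Real.pi * (n i : ℝ) / a i| ≤ L

/-- All sampling points stay at distance at least `δ` from the zeros of the weight, in the sense
that `|λ(n)| ≥ δ` and `|⟨α^j, λ(n)⟩| ≥ δ` for every `j`. -/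
def AvoidsZeros {d m : ℕ} (α : Fin m → EuclideanSpace ℝ (Fin d)) (δ : ℝ)
    (lam : (Fin d → ℤ) → EuclideanSpace ℝ (Fin d)) : Prop :=
  ∀ n : Fin d → ℤ, δ ≤ ‖lam n‖ ∧ ∀ j, δ ≤ |inner ℝ (α j) (lam n)|

section LatticeSums

theorem exists_lattice_center {h : ℝ} (hh : 0 < h) (x : ℝ) :
    ∃ k₀ : ℤ, h * |(k₀ : ℝ)| ≤ |x| + h ∧
      ∀ k : ℤ, min 1 (h / 2) * (1 + |((k - k₀ : ℤ) : ℝ)|) ≤ 1 + |h * k - x| := by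
  refine ⟨round (x / h), ?_, fun k => ?_⟩
  · have h1 := abs_sub_round (x / h)
    have h2 : |(round (x / h) : ℝ)| ≤ |x / h| + 1 / 2 := by
      have := abs_sub_abs_le_abs_sub (round (x / h) : ℝ) (x / h)
      rw [abs_sub_comm] at this
      linarith
    rw [abs_div, abs_of_pos hh] at h2
    have : h * (|x| / h) = |x| := by field_simp
    nlinarith
  · have h1 := abs_sub_round (x / h)
    set k₀ := round (x / h)
    set c := min 1 (h / 2)
    have hc1 : c ≤ 1 := min_le_left _ _
    have hc2 : c ≤ h / 2 := min_le_right _ _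
    have hc0 : 0 < c := lt_min one_pos (by positivity)
    have h2 : |h * k - h * k₀| ≤ |h * k - x| + h / 2 := by
      have e : h * k - h * k₀ = (h * k - x) + h * (x / h - k₀) := by field_simp; ring
      rw [e]
      refine (abs_add_le _ _).trans ?_
      rw [abs_mul, abs_of_pos hh]
      nlinarith
    rw [← mul_sub, abs_mul, abs_of_pos hh] at h2
    push_cast
    rcases eq_or_ne k k₀ with hk | hne
    · have := abs_nonneg (h * k - x)
      rw [hk] at this ⊢
      simp only [sub_self, abs_zero, add_zero, mul_one]
      linarith
    · have : (1 : ℝ) ≤ |(k : ℝ) - k₀| := by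
        exact_mod_cast Int.one_le_abs (sub_ne_zero.mpr hne)
      nlinarith

theorem summable_int_one_add_abs_sq : Summable fun k : ℤ => ((1 + |(k : ℝ)|) ^ 2)⁻¹ := by
  have key : Summable fun n : ℕ => ((1 + (n : ℝ)) ^ 2)⁻¹ := by
    have := (summable_nat_add_iff (f := fun n : ℕ => ((n : ℝ) ^ 2)⁻¹) 1).2
      (Real.summable_nat_pow_inv.2 one_lt_two)
    refine this.congr fun n => ?_
    push_cast
    rw [add_comm]
  refine summable_int_iff_summable_nat_and_neg.2 ⟨?_, ?_⟩
  · simpa using key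
  · simpa using key

theorem exists_sum_lattice_inv_sq_le {h : ℝ} (hh : 0 < h) :
    ∃ C : ℝ, 0 ≤ C ∧ ∀ (x : ℝ) (F : Finset ℤ), ∑ k ∈ F, ((1 + |h * k - x|) ^ 2)⁻¹ ≤ C := by
  set c := min 1 (h / 2)
  have hc0 : 0 < c := lt_min one_pos (by positivity)
  refine ⟨(c ^ 2)⁻¹ * ∑' k : ℤ, ((1 + |(k : ℝ)|) ^ 2)⁻¹, ?_, fun x F => ?_⟩
  · have : 0 ≤ ∑' k : ℤ, ((1 + |(k : ℝ)|) ^ 2)⁻¹ := tsum_nonneg fun k => by positivity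
    positivity
  obtain ⟨k₀, -, hk⟩ := exists_lattice_center hh x
  calc ∑ k ∈ F, ((1 + |h * k - x|) ^ 2)⁻¹
      ≤ ∑ k ∈ F, (c ^ 2)⁻¹ * ((1 + |((k - k₀ : ℤ) : ℝ)|) ^ 2)⁻¹ := by
        refine Finset.sum_le_sum fun k _ => ?_
        rw [← mul_inv, ← mul_pow]
        exact inv_anti₀ (by positivity) (pow_le_pow_left₀ (by positivity) (hk k) 2)
    _ = (c ^ 2)⁻¹ * ∑ k ∈ F.map (Equiv.subRight k₀).toEmbedding, ((1 + |(k : ℝ)|) ^ 2)⁻¹ := by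
        rw [Finset.sum_map, Finset.mul_sum]; rfl
    _ ≤ _ := by
        gcongr
        exact summable_int_one_add_abs_sq.sum_le_tsum _ fun k _ => by positivity

theorem sum_Icc_inv_one_add_abs_le (K : ℕ) :
    ∑ k ∈ Finset.Icc (-(K : ℤ)) K, (1 + |(k : ℝ)|)⁻¹ ≤ 2 * (1 + Real.log (K + 1)) := by
  have h1 := Finset.sum_Icc_of_even_eq_range (f := fun k : ℤ => (1 + |(k : ℝ)|)⁻¹)
    (fun k => by simp) K
  have h2 := harmonic_le_one_add_log (K + 1)
  rw [h1]
  have h3 : ∑ m ∈ Finset.range (K + 1), (1 + |((m : ℤ) : ℝ)|)⁻¹ = (harmonic (K + 1) : ℝ) := by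
    simp [harmonic, add_comm]
  rw [h3]
  push_cast at h2
  simp only [nsmul_eq_mul, Nat.cast_ofNat, Int.cast_zero, abs_zero, add_zero, inv_one]
  linarith

theorem sum_Icc_tail_le (K K₁ : ℕ) (hK : 0 < K₁) :
    ∑ k ∈ (Finset.Icc (-(K : ℤ)) K).filter (fun k => (K₁ : ℤ) < |k|), (K₁ : ℝ) * ((k : ℝ) ^ 2)⁻¹
      ≤ 2 := by
  rw [Finset.sum_filter]
  have h1 := Finset.sum_Icc_of_even_eq_range
    (f := fun k : ℤ => if (K₁ : ℤ) < |k| then (K₁ : ℝ) * ((k : ℝ) ^ 2)⁻¹ else 0)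
    (fun k => by simp) K
  rw [h1]
  have h2 : ∑ m ∈ Finset.range (K + 1),
      (if (K₁ : ℤ) < |(m : ℤ)| then (K₁ : ℝ) * (((m : ℤ) : ℝ) ^ 2)⁻¹ else 0) ≤ 1 := by
    rw [← Finset.sum_filter, ← Finset.mul_sum]
    have h3 : (Finset.range (K + 1)).filter (fun m : ℕ => (K₁ : ℤ) < |(m : ℤ)|) = Finset.Ioc K₁ K := by
      ext m; simp; omega
    rw [h3]
    rcases le_or_gt K₁ K with hle | hgt
    · have h4 := sum_Ioc_inv_sq_le_sub (α := ℝ) hK.ne' hle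
      have h5 : (0 : ℝ) ≤ (K : ℝ)⁻¹ := by positivity
      have hK' : (0 : ℝ) < K₁ := by exact_mod_cast hK
      calc (K₁ : ℝ) * ∑ i ∈ Finset.Ioc K₁ K, (((i : ℤ) : ℝ) ^ 2)⁻¹ ≤ K₁ * (K₁ : ℝ)⁻¹ := by
            gcongr
            simp only [Int.cast_natCast]
            linarith
        _ = 1 := by field_simp
    · rw [Finset.Ioc_eq_empty_of_le hgt.le]; simp
  have h6 : ¬ (K₁ : ℤ) < |(0 : ℤ)| := by simp
  simp only [h6, if_false, sub_zero, nsmul_eq_mul, Nat.cast_ofNat]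
  linarith

/-- Logarithmic control of the sum comparing two near-lattice products at the point `z`. -/
theorem exists_sum_lattice_log_le {h : ℝ} (hh : 0 < h) :
    ∃ C : ℝ, 0 ≤ C ∧ ∀ (z : ℂ) (K : ℕ),
      ∑ k ∈ (Finset.Icc (-(K : ℤ)) K).erase 0, (1 + ‖z‖) / (|(k : ℝ)| * (1 + ‖(h * k : ℂ) - z‖))
        ≤ C * (1 + Real.log (1 + ‖z‖)) := by
  set c := min 1 (h / 2)
  have hc0 : 0 < c := lt_min one_pos (by positivity)
  set A : ℝ := 2 / h + 2 with hA
  have hA0 : 0 < A := by positivity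
  set D : ℝ := h * c⁻¹ + 2 with hD
  have hD0 : 0 < D := by positivity
  refine ⟨D * (2 * (1 + Real.log (2 * A + 3))) + 2 * 2 / h, ?_, fun z K => ?_⟩
  · have : 0 ≤ Real.log (2 * A + 3) := Real.log_nonneg (by linarith)
    positivity
  set T := ‖z‖
  have hT : 0 ≤ T := norm_nonneg z
  have hlogT : 0 ≤ Real.log (1 + T) := Real.log_nonneg (by linarith)
  set K₁ := ⌈A * (1 + T)⌉₊ with hK₁
  have hK1a : A * (1 + T) ≤ K₁ := Nat.le_ceil _
  have hK1b : (K₁ : ℝ) ≤ A * (1 + T) + 1 := (Nat.ceil_lt_add_one (by positivity)).le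
  have hK1pos : 0 < K₁ := Nat.ceil_pos.2 (by positivity)
  obtain ⟨k₀, hk0, hk⟩ := exists_lattice_center hh z.re
  have hre : ∀ k : ℤ, |h * k - z.re| ≤ ‖(h * k : ℂ) - z‖ := fun k => by
    have := Complex.abs_re_le_norm ((h * k : ℂ) - z)
    simpa using this
  have hk0' : |(k₀ : ℝ)| ≤ K₁ := by
    have h1 : |z.re| ≤ T := Complex.abs_re_le_norm z
    have h2 : h * |(k₀ : ℝ)| ≤ h * (A * (1 + T)) := by
      have : h * (A * (1 + T)) = 2 * (1 + T) + 2 * h * (1 + T) := by rw [hA]; field_simp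
      rw [this]; nlinarith
    exact (le_of_mul_le_mul_left h2 hh).trans hK1a
  have hpos : ∀ k : ℤ, k ≠ 0 → (1 : ℝ) ≤ |(k : ℝ)| := fun k hk => by
    exact_mod_cast Int.one_le_abs hk
  set S := (Finset.Icc (-(K : ℤ)) K).erase 0
  rw [← Finset.sum_filter_add_sum_filter_not S (fun k => |k| ≤ (K₁ : ℤ))]
  have hnear : ∑ k ∈ S.filter (fun k => |k| ≤ (K₁ : ℤ)),
      (1 + T) / (|(k : ℝ)| * (1 + ‖(h * k : ℂ) - z‖)) ≤
        D * (2 * (1 + Real.log ((2 * K₁ : ℕ) + 1))) := by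
    have hsub1 : S.filter (fun k => |k| ≤ (K₁ : ℤ)) ⊆ Finset.Icc (-((2 * K₁ : ℕ) : ℤ)) (2 * K₁ : ℕ) := by
      intro k hk
      simp only [Finset.mem_filter, abs_le, Finset.mem_Icc] at hk ⊢
      push_cast
      omega
    have hsub2 : (S.filter (fun k => |k| ≤ (K₁ : ℤ))).map (Equiv.subRight k₀).toEmbedding ⊆
        Finset.Icc (-((2 * K₁ : ℕ) : ℤ)) (2 * K₁ : ℕ) := by
      intro j hj
      have hk0i : |k₀| ≤ (K₁ : ℤ) := by exact_mod_cast hk0'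
      simp only [Finset.mem_map, Finset.mem_filter, Equiv.coe_toEmbedding, Equiv.subRight_apply,
        abs_le, Finset.mem_Icc] at hj hk0i ⊢
      obtain ⟨k, hk, rfl⟩ := hj
      push_cast
      omega
    have hterm : ∀ k ∈ S.filter (fun k => |k| ≤ (K₁ : ℤ)),
        (1 + T) / (|(k : ℝ)| * (1 + ‖(h * k : ℂ) - z‖)) ≤
          h * c⁻¹ * (1 + |((k - k₀ : ℤ) : ℝ)|)⁻¹ + 2 * (1 + |(k : ℝ)|)⁻¹ := by
      intro k hkS
      have hk0 : k ≠ 0 := by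
        simp only [S, Finset.mem_filter, Finset.mem_erase] at hkS
        exact hkS.1.1
      have h1 := hpos k hk0
      set u := ‖(h * k : ℂ) - z‖
      have hu : 0 ≤ u := norm_nonneg _
      have hTu : T ≤ h * |(k : ℝ)| + u := by
        have e : z = (h * k : ℂ) - ((h * k : ℂ) - z) := by ring
        calc T = ‖(h * k : ℂ) - ((h * k : ℂ) - z)‖ := by rw [← e]
          _ ≤ ‖(h * k : ℂ)‖ + u := norm_sub_le _ _
          _ = h * |(k : ℝ)| + u := by
            rw [norm_mul, Complex.norm_real, Real.norm_of_nonneg hh.le, Complex.norm_intCast]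
      have h2 : (1 + T) / (|(k : ℝ)| * (1 + u)) ≤ h * (1 + u)⁻¹ + |(k : ℝ)|⁻¹ := by
        have : h * (1 + u)⁻¹ + |(k : ℝ)|⁻¹ = (h * |(k : ℝ)| + (1 + u)) / (|(k : ℝ)| * (1 + u)) := by
          have : |(k : ℝ)| ≠ 0 := by positivity
          field_simp
        rw [this]
        exact div_le_div_of_nonneg_right (by linarith) (by positivity)
      have h3 : (1 + u)⁻¹ ≤ c⁻¹ * (1 + |((k - k₀ : ℤ) : ℝ)|)⁻¹ := by
        rw [← mul_inv]
        exact inv_anti₀ (by positivity) ((hk k).trans (by linarith [hre k]))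
      have h4 : |(k : ℝ)|⁻¹ ≤ 2 * (1 + |(k : ℝ)|)⁻¹ := by
        rw [← div_eq_mul_inv, inv_eq_one_div, div_le_div_iff₀ (by positivity) (by positivity)]
        linarith
      calc _ ≤ h * (1 + u)⁻¹ + |(k : ℝ)|⁻¹ := h2
        _ ≤ h * (c⁻¹ * (1 + |((k - k₀ : ℤ) : ℝ)|)⁻¹) + 2 * (1 + |(k : ℝ)|)⁻¹ := by gcongr
        _ = _ := by ring
    refine (Finset.sum_le_sum hterm).trans ?_
    rw [Finset.sum_add_distrib, ← Finset.mul_sum, ← Finset.mul_sum]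
    have e1 : ∑ k ∈ S.filter (fun k => |k| ≤ (K₁ : ℤ)), (1 + |((k - k₀ : ℤ) : ℝ)|)⁻¹ ≤
        2 * (1 + Real.log ((2 * K₁ : ℕ) + 1)) := by
      refine le_trans ?_ (sum_Icc_inv_one_add_abs_le (2 * K₁))
      refine le_trans (le_of_eq ?_) (Finset.sum_le_sum_of_subset_of_nonneg hsub2
        fun j _ _ => by positivity)
      rw [Finset.sum_map]; rfl
    have e2 : ∑ k ∈ S.filter (fun k => |k| ≤ (K₁ : ℤ)), (1 + |(k : ℝ)|)⁻¹ ≤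
        2 * (1 + Real.log ((2 * K₁ : ℕ) + 1)) :=
      (Finset.sum_le_sum_of_subset_of_nonneg hsub1 fun j _ _ => by positivity).trans
        (sum_Icc_inv_one_add_abs_le (2 * K₁))
    rw [hD, add_mul]
    gcongr
  have hfar : ∑ k ∈ S.filter (fun k => ¬ |k| ≤ (K₁ : ℤ)),
      (1 + T) / (|(k : ℝ)| * (1 + ‖(h * k : ℂ) - z‖)) ≤ 2 * 2 / h := by
    have hterm : ∀ k ∈ S.filter (fun k => ¬ |k| ≤ (K₁ : ℤ)),
        (1 + T) / (|(k : ℝ)| * (1 + ‖(h * k : ℂ) - z‖)) ≤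
          2 / h * ((K₁ : ℝ) * ((k : ℝ) ^ 2)⁻¹) := by
      intro k hkS
      have hkK : (K₁ : ℝ) < |(k : ℝ)| := by
        have := (Finset.mem_filter.1 hkS).2
        exact_mod_cast not_le.1 this
      have hkp : 0 < |(k : ℝ)| := lt_of_le_of_lt (by positivity) hkK
      set u := ‖(h * k : ℂ) - z‖
      have hA1 : 1 + T ≤ h / 2 * K₁ := by
        have : h / 2 * (A * (1 + T)) = (1 + T) + h * (1 + T) := by rw [hA]; field_simp
        nlinarith
      have hA2 : 1 + T ≤ K₁ := by
        have : 1 ≤ A := by rw [hA]; have : 0 < 2 / h := by positivity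
                           linarith
        nlinarith
      have hu : h * |(k : ℝ)| ≤ u + T := by
        calc h * |(k : ℝ)| = ‖(h * k : ℂ)‖ := by
              rw [norm_mul, Complex.norm_real, Real.norm_of_nonneg hh.le, Complex.norm_intCast]
          _ = ‖((h * k : ℂ) - z) + z‖ := by rw [sub_add_cancel]
          _ ≤ u + T := norm_add_le _ _
      have hden : h / 2 * |(k : ℝ)| ≤ 1 + u := by nlinarith
      calc (1 + T) / (|(k : ℝ)| * (1 + u)) ≤ K₁ / (|(k : ℝ)| * (h / 2 * |(k : ℝ)|)) := by gcongr
        _ = 2 / h * ((K₁ : ℝ) * ((k : ℝ) ^ 2)⁻¹) := by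
          rw [← sq_abs (k : ℝ)]; field_simp
    refine (Finset.sum_le_sum hterm).trans ?_
    rw [← Finset.mul_sum]
    have hsub : S.filter (fun k => ¬ |k| ≤ (K₁ : ℤ)) ⊆
        (Finset.Icc (-(K : ℤ)) K).filter (fun k => (K₁ : ℤ) < |k|) := by
      intro k hk
      simp only [S, Finset.mem_filter, Finset.mem_erase, not_le] at hk ⊢
      exact ⟨hk.1.2, hk.2⟩
    have := (Finset.sum_le_sum_of_subset_of_nonneg hsub
      (f := fun k : ℤ => (K₁ : ℝ) * ((k : ℝ) ^ 2)⁻¹) fun j _ _ => by positivity).trans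
      (sum_Icc_tail_le K K₁ hK1pos)
    calc _ ≤ 2 / h * 2 := by gcongr
      _ = _ := by ring
  have hlog : Real.log ((2 * K₁ : ℕ) + 1) ≤ Real.log (2 * A + 3) + Real.log (1 + T) := by
    rw [← Real.log_mul (by positivity) (by positivity)]
    refine Real.log_le_log (by positivity) ?_
    push_cast
    nlinarith
  have hlogA : 0 ≤ Real.log (2 * A + 3) := Real.log_nonneg (by linarith)
  have hh2 : (0 : ℝ) ≤ 2 * 2 / h := by positivity
  have hfin : D * (2 * (1 + Real.log ((2 * K₁ : ℕ) + 1))) ≤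
      D * (2 * (1 + Real.log (2 * A + 3))) * (1 + Real.log (1 + T)) := by
    have : 1 + Real.log ((2 * K₁ : ℕ) + 1) ≤ (1 + Real.log (2 * A + 3)) * (1 + Real.log (1 + T)) := by
      nlinarith
    calc _ ≤ D * (2 * ((1 + Real.log (2 * A + 3)) * (1 + Real.log (1 + T)))) := by gcongr
      _ = _ := by ring
  nlinarith

end LatticeSums

section GeneratingFunction

open Filter Topology

/-- `t` itself if `1 ≤ |t|`, and `1` otherwise. -/
noncomputable def nzPart (t : ℝ) : ℝ := if 1 ≤ |t| then t else 1

theorem one_le_abs_nzPart (t : ℝ) : 1 ≤ |nzPart t| := by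
  unfold nzPart; split_ifs with h
  · exact h
  · simp

theorem nzPart_ne_zero (t : ℝ) : nzPart t ≠ 0 := fun h => by
  have := one_le_abs_nzPart t
  rw [h, abs_zero] at this
  linarith

theorem abs_le_abs_nzPart (t : ℝ) : |t| ≤ |nzPart t| := by
  unfold nzPart; split_ifs with h
  · exact le_rfl
  · simpa using (not_le.1 h).le

theorem abs_nzPart_sub_le (t : ℝ) : |nzPart t - t| ≤ 2 := by
  unfold nzPart; split_ifs with h
  · simp
  · rw [not_le, abs_lt] at h
    rw [abs_le]; constructor <;> linarith

/-- The linear factor with zero `lam k` of the generating function. -/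
noncomputable def genFactor (lam : ℤ → ℝ) (k : ℤ) (z : ℂ) : ℂ := ((lam k : ℂ) - z) / (nzPart (lam k) : ℂ)

/-- The symmetric partial products of the generating function. -/
noncomputable def partialGen (lam : ℤ → ℝ) (K : ℕ) (z : ℂ) : ℂ :=
  ∏ k ∈ Finset.Icc (-(K : ℤ)) K, genFactor lam k z

/-- The entire function whose zeros are the points of the sequence `lam`. -/
noncomputable def genFun (lam : ℤ → ℝ) (z : ℂ) : ℂ :=
  genFactor lam 0 z *
    ∏' k : ℕ, (1 + (genFactor lam (k + 1) z * genFactor lam (-(k + 1)) z - 1))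

theorem Finset.prod_Icc_neg_eq {R : Type*} [CommMonoid R] (f : ℤ → R) (K : ℕ) :
    ∏ k ∈ Finset.Icc (-(K : ℤ)) K, f k = f 0 * ∏ k ∈ Finset.range K, (f (k + 1) * f (-(k + 1))) := by
  induction K with
  | zero => simp
  | succ K ih =>
    have h : Finset.Icc (-((K + 1 : ℕ) : ℤ)) (K + 1 : ℕ) =
        insert ((K : ℤ) + 1) (insert (-((K : ℤ) + 1)) (Finset.Icc (-(K : ℤ)) K)) := by
      ext k; simp only [Finset.mem_Icc, Finset.mem_insert]; push_cast; omega
    rw [h, Finset.prod_insert, Finset.prod_insert, ih, Finset.prod_range_succ]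
    · rw [← mul_assoc, mul_comm, mul_assoc]
    · simp
    · simp only [Finset.mem_insert, Finset.mem_Icc]; omega

variable {h L : ℝ} {lam : ℤ → ℝ}

theorem abs_lattice_le_nzPart (hL : 0 ≤ L) (hn : ∀ k : ℤ, |lam k - h * k| ≤ L) (k : ℤ) :
    |h * k| ≤ (1 + L) * |nzPart (lam k)| := by
  have h1 := one_le_abs_nzPart (lam k)
  have h2 := abs_le_abs_nzPart (lam k)
  have h3 : |h * k| ≤ |lam k| + |lam k - h * k| := by
    have := abs_sub_abs_le_abs_sub (h * k) (lam k)
    rw [abs_sub_comm (h * k)] at this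
    linarith
  nlinarith [hn k]

theorem abs_lattice_le_of_nzPart_ne (hn : ∀ k : ℤ, |lam k - h * k| ≤ L) {k : ℤ}
    (hk : nzPart (lam k) ≠ lam k) : |h * k| ≤ 1 + L := by
  have h1 : |lam k| < 1 := by
    by_contra hc
    exact hk (if_pos (not_lt.1 hc))
  have h3 : |h * k| ≤ |lam k| + |lam k - h * k| := by
    have := abs_sub_abs_le_abs_sub (h * k) (lam k)
    rw [abs_sub_comm (h * k)] at this
    linarith
  linarith [hn k]

theorem norm_genFactor_pair_sub_one_le (hh : 0 < h) (hL : 0 ≤ L) (hn : ∀ k : ℤ, |lam k - h * k| ≤ L)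
    {R : ℝ} {z : ℂ} (hz : ‖z‖ ≤ R) (k : ℕ) :
    ‖genFactor lam (k + 1) z * genFactor lam (-(k + 1)) z - 1‖ ≤
      (10 * (L + 2) ^ 2 + R * (2 * L) + R ^ 2) * (1 + L) ^ 2 / h ^ 2 * (((k + 1 : ℕ) : ℝ) ^ 2)⁻¹ := by
  set p := lam (k + 1)
  set q := lam (-(k + 1))
  set b := nzPart p
  set b' := nzPart q
  have hb : b ≠ 0 := nzPart_ne_zero p
  have hb' : b' ≠ 0 := nzPart_ne_zero q
  have hbC : (b : ℂ) ≠ 0 := by exact_mod_cast hb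
  have hbC' : (b' : ℂ) ≠ 0 := by exact_mod_cast hb'
  have hR : 0 ≤ R := (norm_nonneg z).trans hz
  have hp := hn (k + 1)
  have hq := hn (-(k + 1))
  have hlb := abs_lattice_le_nzPart hL hn (k + 1)
  have hlb' := abs_lattice_le_nzPart hL hn (-(k + 1))
  push_cast at hp hq hlb hlb'
  have habs : |h * ((k : ℝ) + 1)| = h * (k + 1) := abs_of_nonneg (by positivity)
  have habs' : |h * (-((k : ℝ) + 1))| = h * (k + 1) := by rw [mul_neg, abs_neg, habs]
  have hsum : |p + q| ≤ 2 * L := by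
    have : p + q = (p - h * (k + 1)) + (q - h * (-(k + 1))) := by ring
    rw [this]
    exact (abs_add_le _ _).trans (by linarith)
  have hconst : |p * q - b * b'| ≤ 10 * (L + 2) ^ 2 := by
    by_cases hcase : b = p ∧ b' = q
    · rw [hcase.1, hcase.2, sub_self, abs_zero]; positivity
    · have hk : h * ((k : ℝ) + 1) ≤ 1 + L := by
        rcases not_and_or.1 hcase with hc | hc
        · have := abs_lattice_le_of_nzPart_ne hn hc
          push_cast at this
          rwa [habs] at this
        · have := abs_lattice_le_of_nzPart_ne hn hc
          push_cast at this
          rwa [habs'] at this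
      have e1 : |p| ≤ 2 * L + 1 := by
        rw [abs_le] at hp ⊢
        constructor <;> nlinarith [hp.1, hp.2, (by positivity : 0 ≤ h * ((k : ℝ) + 1))]
      have e2 : |q| ≤ 2 * L + 1 := by
        rw [abs_le] at hq ⊢
        constructor <;> nlinarith [hq.1, hq.2, (by positivity : 0 ≤ h * ((k : ℝ) + 1))]
      have e3 : |b| ≤ 2 * L + 3 := by
        have := abs_sub_abs_le_abs_sub b p
        linarith [abs_nzPart_sub_le p]
      have e4 : |b'| ≤ 2 * L + 3 := by
        have := abs_sub_abs_le_abs_sub b' q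
        linarith [abs_nzPart_sub_le q]
      calc |p * q - b * b'| ≤ |p * q| + |b * b'| := abs_sub _ _
        _ = |p| * |q| + |b| * |b'| := by rw [abs_mul, abs_mul]
        _ ≤ (2 * L + 1) * (2 * L + 1) + (2 * L + 3) * (2 * L + 3) := by gcongr
        _ ≤ _ := by nlinarith
  have e : genFactor lam (k + 1) z * genFactor lam (-(k + 1)) z - 1 =
      (((p * q - b * b' : ℝ) : ℂ) - z * ((p + q : ℝ) : ℂ) + z ^ 2) / (((b * b' : ℝ)) : ℂ) := by
    change ((p : ℂ) - z) / (b : ℂ) * (((q : ℂ) - z) / (b' : ℂ)) - 1 = _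
    push_cast
    field_simp
    ring
  have hnum : ‖((p * q - b * b' : ℝ) : ℂ) - z * ((p + q : ℝ) : ℂ) + z ^ 2‖ ≤
      10 * (L + 2) ^ 2 + R * (2 * L) + R ^ 2 := by
    refine (norm_add_le _ _).trans (add_le_add ((norm_sub_le _ _).trans (add_le_add ?_ ?_)) ?_)
    · rw [Complex.norm_real]; exact hconst
    · rw [norm_mul, Complex.norm_real]
      exact mul_le_mul hz hsum (abs_nonneg _) hR
    · rw [norm_pow]; gcongr
  have hden : h ^ 2 * ((k : ℝ) + 1) ^ 2 / (1 + L) ^ 2 ≤ |b * b'| := by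
    rw [abs_mul, div_le_iff₀ (by positivity)]
    rw [habs] at hlb
    rw [habs'] at hlb'
    calc h ^ 2 * ((k : ℝ) + 1) ^ 2 = (h * (k + 1)) * (h * (k + 1)) := by ring
      _ ≤ ((1 + L) * |b|) * ((1 + L) * |b'|) := by gcongr
      _ = _ := by ring
  rw [e, norm_div, Complex.norm_real, Real.norm_eq_abs]
  calc _ ≤ (10 * (L + 2) ^ 2 + R * (2 * L) + R ^ 2) / (h ^ 2 * ((k : ℝ) + 1) ^ 2 / (1 + L) ^ 2) := by
        gcongr
    _ = _ := by push_cast; field_simp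

theorem continuous_genFactor (lam : ℤ → ℝ) (k : ℤ) : Continuous (genFactor lam k) := by
  unfold genFactor; fun_prop

theorem differentiable_genFactor (lam : ℤ → ℝ) (k : ℤ) : Differentiable ℂ (genFactor lam k) := by
  unfold genFactor; fun_prop

theorem tendstoLocallyUniformlyOn_pairs (hh : 0 < h) (hL : 0 ≤ L)
    (hn : ∀ k : ℤ, |lam k - h * k| ≤ L) (R : ℝ) :
    TendstoLocallyUniformlyOn
      (fun (K : ℕ) z => ∏ k ∈ Finset.range K,
        (1 + (genFactor lam (k + 1) z * genFactor lam (-(k + 1)) z - 1)))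
      (fun z => ∏' k : ℕ, (1 + (genFactor lam (k + 1) z * genFactor lam (-(k + 1)) z - 1)))
      atTop (Metric.ball 0 R) := by
  refine HasProdLocallyUniformlyOn.tendstoLocallyUniformlyOn_finsetRange ?_
  refine Summable.hasProdLocallyUniformlyOn_nat_one_add
    (u := fun k : ℕ => (10 * (L + 2) ^ 2 + R * (2 * L) + R ^ 2) * (1 + L) ^ 2 / h ^ 2 *
      (((k + 1 : ℕ) : ℝ) ^ 2)⁻¹) Metric.isOpen_ball ?_ ?_ ?_
  · refine Summable.mul_left _ ?_
    exact (summable_nat_add_iff (f := fun n : ℕ => ((n : ℝ) ^ 2)⁻¹) 1).2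
      (Real.summable_nat_pow_inv.2 one_lt_two)
  · refine Eventually.of_forall fun k z hz => norm_genFactor_pair_sub_one_le hh hL hn ?_ k
    exact (mem_ball_zero_iff.1 hz).le
  · intro k
    exact (((continuous_genFactor lam _).mul (continuous_genFactor lam _)).sub
      continuous_const).continuousOn

theorem tendsto_partialGen (hh : 0 < h) (hL : 0 ≤ L) (hn : ∀ k : ℤ, |lam k - h * k| ≤ L) (z : ℂ) :
    Tendsto (fun K => partialGen lam K z) atTop (𝓝 (genFun lam z)) := by
  have h1 := (tendstoLocallyUniformlyOn_pairs hh hL hn (‖z‖ + 1)).tendsto_at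
    (mem_ball_zero_iff.2 (lt_add_one ‖z‖))
  refine (h1.const_mul (genFactor lam 0 z)).congr fun K => ?_
  simp only [add_sub_cancel]
  exact (Finset.prod_Icc_neg_eq (fun k => genFactor lam k z) K).symm

theorem differentiable_genFun (hh : 0 < h) (hL : 0 ≤ L) (hn : ∀ k : ℤ, |lam k - h * k| ≤ L) :
    Differentiable ℂ (genFun lam) := by
  intro z
  have h1 := (tendstoLocallyUniformlyOn_pairs hh hL hn (‖z‖ + 1)).differentiableOn
    (Eventually.of_forall fun K => ?_) Metric.isOpen_ball
  · have h2 := h1.differentiableAt (Metric.isOpen_ball.mem_nhds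
      (mem_ball_zero_iff.2 (lt_add_one ‖z‖)))
    exact (differentiable_genFactor lam 0 z).mul h2
  · refine Differentiable.differentiableOn ?_
    refine Differentiable.fun_finsetProd fun k _ => ?_
    have a := differentiable_genFactor lam (k + 1)
    have b := differentiable_genFactor lam (-(k + 1))
    fun_prop

theorem one_add_norm_lattice_sub_le (hL : 0 ≤ L) (hn : ∀ k : ℤ, |lam k - h * k| ≤ L) {r : ℝ}
    (hr : 0 < r) {k : ℤ} {z : ℂ} (hz : r ≤ ‖(lam k : ℂ) - z‖) :
    1 + ‖(h * k : ℂ) - z‖ ≤ (1 + (1 + L) / r) * ‖(lam k : ℂ) - z‖ := by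
  have h1 : ‖(h * k : ℂ) - z‖ ≤ ‖(lam k : ℂ) - z‖ + L := by
    have e : (h * k : ℂ) - z = ((lam k : ℂ) - z) - ((lam k - h * k : ℝ) : ℂ) := by push_cast; ring
    rw [e]
    refine (norm_sub_le _ _).trans ?_
    rw [Complex.norm_real]
    exact add_le_add le_rfl (hn k)
  have h2 : 1 + L ≤ (1 + L) / r * ‖(lam k : ℂ) - z‖ := by
    rw [div_mul_eq_mul_div, le_div_iff₀ hr]
    gcongr
  linarith

theorem exists_prod_norm_vertical_le (hh : 0 < h) (hL : 0 ≤ L) {r : ℝ} (hr : 0 < r) :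
    ∃ C : ℝ, 0 < C ∧ ∀ lam : ℤ → ℝ, (∀ k : ℤ, |lam k - h * k| ≤ L) → ∀ z z' : ℂ, z.re = z'.re →
      |z'.im| ≤ 1 → ∀ F : Finset ℤ, (∀ k ∈ F, r ≤ ‖(lam k : ℂ) - z‖) →
        ∏ k ∈ F, ‖(lam k : ℂ) - z'‖ ≤ C * ∏ k ∈ F, ‖(lam k : ℂ) - z‖ := by
  obtain ⟨S, hS0, hS⟩ := exists_sum_lattice_inv_sq_le hh
  set B := 1 + (1 + L) / r
  have hB : 0 < B := by positivity
  refine ⟨Real.exp (B ^ 2 * S), Real.exp_pos _, fun lam hn z z' hre him F hF => ?_⟩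
  have key : ∀ k ∈ F, ‖(lam k : ℂ) - z'‖ ≤
      Real.exp (B ^ 2 * ((1 + |h * k - z.re|) ^ 2)⁻¹) * ‖(lam k : ℂ) - z‖ := by
    intro k hk
    set u := ‖(lam k : ℂ) - z‖ with hu
    have hur : r ≤ u := hF k hk
    have hu0 : 0 < u := hr.trans_le hur
    have h1 : ‖(lam k : ℂ) - z'‖ ^ 2 ≤ u ^ 2 + 1 := by
      rw [hu, ← Complex.normSq_eq_norm_sq, ← Complex.normSq_eq_norm_sq, Complex.normSq_apply,
        Complex.normSq_apply]
      simp only [Complex.sub_re, Complex.ofReal_re, Complex.sub_im, Complex.ofReal_im, hre]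
      have : z'.im ^ 2 ≤ 1 := (sq_le_one_iff_abs_le_one _).2 him
      nlinarith [sq_nonneg z.im]
    have h2 : 1 / u ^ 2 ≤ B ^ 2 * ((1 + |h * k - z.re|) ^ 2)⁻¹ := by
      have h3 := one_add_norm_lattice_sub_le hL hn hr hur
      have h4 : |h * k - z.re| ≤ ‖(h * k : ℂ) - z‖ := by
        have := Complex.abs_re_le_norm ((h * k : ℂ) - z)
        simpa using this
      rw [← div_eq_mul_inv, div_le_div_iff₀ (by positivity) (by positivity), one_mul, ← mul_pow]
      exact pow_le_pow_left₀ (by positivity) (by linarith) 2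
    have h5 : ‖(lam k : ℂ) - z'‖ ≤ Real.exp (1 / u ^ 2) * u := by
      refine le_of_sq_le_sq ?_ (by positivity)
      have h6 : 1 / u ^ 2 + 1 ≤ Real.exp (1 / u ^ 2) := Real.add_one_le_exp _
      have h7 : (0 : ℝ) ≤ 1 / u ^ 2 := by positivity
      calc ‖(lam k : ℂ) - z'‖ ^ 2 ≤ u ^ 2 + 1 := h1
        _ = (1 / u ^ 2 + 1) * 1 * u ^ 2 := by field_simp; ring
        _ ≤ Real.exp (1 / u ^ 2) * Real.exp (1 / u ^ 2) * u ^ 2 := by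
          gcongr
          exact Real.one_le_exp h7
        _ = (Real.exp (1 / u ^ 2) * u) ^ 2 := by ring
    refine h5.trans ?_
    gcongr
  calc ∏ k ∈ F, ‖(lam k : ℂ) - z'‖
      ≤ ∏ k ∈ F, (Real.exp (B ^ 2 * ((1 + |h * k - z.re|) ^ 2)⁻¹) * ‖(lam k : ℂ) - z‖) :=
        Finset.prod_le_prod (fun _ _ => norm_nonneg _) key
    _ = Real.exp (B ^ 2 * ∑ k ∈ F, ((1 + |h * k - z.re|) ^ 2)⁻¹) * ∏ k ∈ F, ‖(lam k : ℂ) - z‖ := by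
        rw [Finset.prod_mul_distrib, ← Real.exp_sum, Finset.mul_sum]
    _ ≤ _ := by
        gcongr
        exact hS _ _

theorem norm_partialGen (lam : ℤ → ℝ) (K : ℕ) (z : ℂ) :
    ‖partialGen lam K z‖ = (∏ k ∈ Finset.Icc (-(K : ℤ)) K, ‖(lam k : ℂ) - z‖) *
      ∏ k ∈ Finset.Icc (-(K : ℤ)) K, |nzPart (lam k)|⁻¹ := by
  unfold partialGen genFactor
  rw [norm_prod, ← Finset.prod_mul_distrib]
  refine Finset.prod_congr rfl fun k _ => ?_
  rw [norm_div, Complex.norm_real, div_eq_mul_inv, Real.norm_eq_abs]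

theorem exists_norm_genFun_vertical_le (hh : 0 < h) (hL : 0 ≤ L) {r : ℝ} (hr : 0 < r) :
    ∃ C : ℝ, 0 < C ∧ ∀ lam : ℤ → ℝ, (∀ k : ℤ, |lam k - h * k| ≤ L) → ∀ z z' : ℂ, z.re = z'.re →
      |z'.im| ≤ 1 → (∀ k, r ≤ ‖(lam k : ℂ) - z‖) → ‖genFun lam z'‖ ≤ C * ‖genFun lam z‖ := by
  obtain ⟨C, hC, H⟩ := exists_prod_norm_vertical_le hh hL hr
  refine ⟨C, hC, fun lam hn z z' hre him hk => ?_⟩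
  refine le_of_tendsto_of_tendsto (tendsto_partialGen hh hL hn z').norm
    ((tendsto_partialGen hh hL hn z).norm.const_mul C) (Eventually.of_forall fun K => ?_)
  simp only [norm_partialGen, ← mul_assoc]
  exact mul_le_mul_of_nonneg_right (H lam hn z z' hre him _ fun k _ => hk k)
    (Finset.prod_nonneg fun _ _ => by positivity)

theorem genFun_apply_self (hh : 0 < h) (hL : 0 ≤ L) (hn : ∀ k : ℤ, |lam k - h * k| ≤ L) (n : ℤ) :
    genFun lam (lam n) = 0 := by
  refine tendsto_nhds_unique (tendsto_partialGen hh hL hn (lam n)) ?_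
  refine tendsto_const_nhds.congr' ?_
  filter_upwards [eventually_ge_atTop n.natAbs] with K hK
  symm
  refine Finset.prod_eq_zero (i := n) (by simp only [Finset.mem_Icc]; omega) ?_
  simp [genFactor]

theorem exists_norm_genFun_le_deriv (hh : 0 < h) (hL : 0 ≤ L) {δ : ℝ} (hδ : 0 < δ) :
    ∃ C : ℝ, 0 < C ∧ ∀ lam : ℤ → ℝ, (∀ k : ℤ, |lam k - h * k| ≤ L) →
      (∀ k l, k ≠ l → δ ≤ |lam k - lam l|) → ∀ n : ℤ,
        ‖genFun lam (lam n + Complex.I)‖ ≤ C * ‖deriv (genFun lam) (lam n)‖ := by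
  obtain ⟨C, hC, H⟩ := exists_prod_norm_vertical_le hh hL hδ
  refine ⟨C, hC, fun lam hn hsep n => ?_⟩
  have key : ∀ η : ℝ, 0 < η → η * ‖genFun lam (lam n + Complex.I)‖ ≤
      C * ‖genFun lam (lam n + η * Complex.I)‖ := by
    intro η hη
    refine le_of_tendsto_of_tendsto ((tendsto_partialGen hh hL hn _).norm.const_mul η)
      ((tendsto_partialGen hh hL hn _).norm.const_mul C) ?_
    filter_upwards [eventually_ge_atTop n.natAbs] with K hK
    simp only [norm_partialGen, ← mul_assoc]
    have hmem : n ∈ Finset.Icc (-(K : ℤ)) K := by simp only [Finset.mem_Icc]; omega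
    refine mul_le_mul_of_nonneg_right ?_ (Finset.prod_nonneg fun _ _ => by positivity)
    rw [← Finset.mul_prod_erase _ _ hmem, ← Finset.mul_prod_erase _ _ hmem]
    have e1 : ‖(lam n : ℂ) - (lam n + Complex.I)‖ = 1 := by simp
    have e2 : ‖(lam n : ℂ) - (lam n + η * Complex.I)‖ = η := by simp [abs_of_pos hη]
    rw [e1, e2, one_mul, mul_left_comm]
    gcongr
    refine H lam hn _ _ (by simp) (by simp) _ fun k hk => ?_
    refine (hsep k n (Finset.ne_of_mem_erase hk)).trans ?_
    have := Complex.abs_re_le_norm ((lam k : ℂ) - (lam n + η * Complex.I))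
    simpa using this
  have hderiv := (differentiable_genFun hh hL hn (lam n)).hasDerivAt.tendsto_slope
  have hpath : Tendsto (fun η : ℝ => (lam n : ℂ) + η * Complex.I) (𝓝[>] 0) (𝓝[≠] (lam n : ℂ)) := by
    refine tendsto_nhdsWithin_iff.2 ⟨?_, ?_⟩
    · refine Tendsto.mono_left ?_ nhdsWithin_le_nhds
      exact Continuous.tendsto' (by fun_prop) _ _ (by simp)
    · filter_upwards [self_mem_nhdsWithin] with η hη
      simpa using (ne_of_gt hη : η ≠ 0)
  refine ge_of_tendsto ((hderiv.comp hpath).norm.const_mul C) ?_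
  filter_upwards [self_mem_nhdsWithin] with η hη
  have hη' : 0 < η := hη
  simp only [Function.comp, slope_def_field, genFun_apply_self hh hL hn n, sub_zero,
    add_sub_cancel_left, norm_div, norm_mul, Complex.norm_real, Complex.norm_I, mul_one,
    Real.norm_of_nonneg hη'.le]
  rw [← mul_div_assoc, le_div_iff₀ hη', mul_comm]
  exact key η hη'

theorem norm_genFun_zero_le (hh : 0 < h) (hL : 0 ≤ L) (hn : ∀ k : ℤ, |lam k - h * k| ≤ L) (n : ℤ) :
    ‖genFun lam 0‖ ≤ |lam n| := by
  refine le_of_tendsto (tendsto_partialGen hh hL hn 0).norm ?_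
  filter_upwards [eventually_ge_atTop n.natAbs] with K hK
  have hmem : n ∈ Finset.Icc (-(K : ℤ)) K := by simp only [Finset.mem_Icc]; omega
  have hone : ∀ k, ‖genFactor lam k 0‖ ≤ 1 := fun k => by
    have : 0 < |nzPart (lam k)| := abs_pos.2 (nzPart_ne_zero _)
    simp only [genFactor, sub_zero, norm_div, Complex.norm_real, Real.norm_eq_abs]
    exact (div_le_one this).2 (abs_le_abs_nzPart _)
  unfold partialGen
  rw [norm_prod, ← Finset.mul_prod_erase _ _ hmem]
  have h1 : ‖genFactor lam n 0‖ ≤ |lam n| := by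
    simp only [genFactor, sub_zero, norm_div, Complex.norm_real, Real.norm_eq_abs]
    exact div_le_self (abs_nonneg _) (one_le_abs_nzPart _)
  have h2 : ∏ k ∈ (Finset.Icc (-(K : ℤ)) K).erase n, ‖genFactor lam k 0‖ ≤ 1 :=
    Finset.prod_le_one (fun _ _ => norm_nonneg _) fun k _ => hone k
  calc _ ≤ |lam n| * 1 := by gcongr
    _ = _ := mul_one _

end GeneratingFunction

section GeneratingFunctionLowerBound

open Filter Topology

/-- The factors of the symmetric product for `sin (π z / h)`. -/
noncomputable def sinFactor (h : ℝ) (k : ℤ) (z : ℂ) : ℂ :=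
  if k = 0 then z else ((h * k : ℂ) - z) / (h * k : ℂ)

theorem tendsto_prod_sinFactor {h : ℝ} (hh : 0 < h) (z : ℂ) :
    Tendsto (fun K : ℕ => ∏ k ∈ Finset.Icc (-(K : ℤ)) K, sinFactor h k z) atTop
      (𝓝 (h / Real.pi * Complex.sin (Real.pi * (z / h)))) := by
  have hhC : (h : ℂ) ≠ 0 := by exact_mod_cast hh.ne'
  have hpi : (Real.pi : ℂ) ≠ 0 := by exact_mod_cast Real.pi_ne_zero
  refine ((Complex.tendsto_euler_sin_prod (z / h)).const_mul ((h : ℂ) / Real.pi)).congr fun K => ?_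
  rw [Finset.prod_Icc_neg_eq, ← mul_assoc]
  congr 1
  · simp only [sinFactor, if_true]; field_simp
  · refine Finset.prod_congr rfl fun j _ => ?_
    have h1 : ((j : ℤ) + 1) ≠ 0 := by omega
    have h2 : (-((j : ℤ) + 1)) ≠ 0 := by omega
    have h3 : ((j : ℂ) + 1) ≠ 0 := by exact_mod_cast Nat.succ_ne_zero j
    simp only [sinFactor, h1, h2, if_false]
    push_cast
    have h4 : -1 + -(j : ℂ) ≠ 0 := fun hc => h3 (by linear_combination -hc)
    field_simp
    ring

theorem exists_le_norm_sin {h : ℝ} (hh : 0 < h) :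
    ∃ c : ℝ, 0 < c ∧ ∀ z : ℂ, 1 ≤ |z.im| →
      c * Real.exp (Real.pi / h * |z.im|) ≤ ‖Complex.sin (Real.pi * (z / h))‖ := by
  have hlt : Real.exp (-(2 * (Real.pi / h))) < 1 := by
    rw [Real.exp_lt_one_iff]; have := Real.pi_pos; simp; positivity
  refine ⟨(1 - Real.exp (-(2 * (Real.pi / h)))) / 2, by linarith, fun z hz => ?_⟩
  set w : ℂ := Real.pi * (z / h)
  have hw : w.im = Real.pi / h * z.im := by
    simp only [w, Complex.im_ofReal_mul, Complex.div_ofReal_im]; ring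
  have hpos : 0 < Real.pi / h := div_pos Real.pi_pos hh
  set t := Real.pi / h * |z.im| with ht
  have htw : |w.im| = t := by rw [hw, abs_mul, abs_of_pos hpos]
  have h1 : (Real.exp t - Real.exp (-t)) / 2 ≤ ‖Complex.sin w‖ := by
    have e : Complex.sin w = (Complex.exp (-w * Complex.I) - Complex.exp (w * Complex.I)) * Complex.I / 2 := rfl
    have n1 : ‖Complex.exp (-w * Complex.I)‖ = Real.exp w.im := by simp [Complex.norm_exp]
    have n2 : ‖Complex.exp (w * Complex.I)‖ = Real.exp (-w.im) := by simp [Complex.norm_exp]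
    rw [e, norm_div, norm_mul, Complex.norm_I, mul_one, Complex.norm_ofNat]
    gcongr
    have h2 := abs_norm_sub_norm_le (Complex.exp (-w * Complex.I)) (Complex.exp (w * Complex.I))
    rw [n1, n2] at h2
    refine le_trans ?_ h2
    rcases abs_cases w.im with ⟨hc, -⟩ | ⟨hc, -⟩
    · rw [← htw, hc]; exact le_abs_self _
    · rw [← htw, hc, neg_neg, abs_sub_comm]; exact le_abs_self _
  refine le_trans ?_ h1
  have h3 : Real.exp (-t) ≤ Real.exp (-(2 * (Real.pi / h))) * Real.exp t := by
    rw [← Real.exp_add]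
    refine Real.exp_le_exp.2 ?_
    nlinarith
  linarith

/-- Away from the real axis the generating function is at least as large as the sine, up to a
polynomial factor. -/
theorem exists_le_norm_genFun {h L : ℝ} (hh : 0 < h) (hL : 0 ≤ L) :
    ∃ c M : ℝ, 0 < c ∧ 0 ≤ M ∧ ∀ lam : ℤ → ℝ, (∀ k : ℤ, |lam k - h * k| ≤ L) → ∀ z : ℂ,
      1 ≤ |z.im| → c * Real.exp (Real.pi / h * |z.im|) ≤ (1 + ‖z‖) ^ M * ‖genFun lam z‖ := by
  obtain ⟨c₀, hc₀, Hsin⟩ := exists_le_norm_sin hh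
  obtain ⟨S, hS0, HS⟩ := exists_sum_lattice_log_le hh
  set E := 3 * L + 4
  set D := E * (2 + L) / h
  have hD : 0 < D := by positivity
  set B := (1 + L) ^ 2 * Real.exp (D * S)
  have hB : 0 < B := by positivity
  refine ⟨c₀ * (h / Real.pi) / B, D * S, by have := Real.pi_pos; positivity, by positivity,
    fun lam hn z hz => ?_⟩
  have hdist : ∀ k, 1 ≤ ‖(lam k : ℂ) - z‖ := fun k => by
    refine hz.trans ?_
    have := Complex.abs_im_le_norm ((lam k : ℂ) - z)
    simpa using this
  have hT : 0 ≤ ‖z‖ := norm_nonneg z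
  have hzero : ‖sinFactor h 0 z‖ ≤ (1 + L) ^ 2 * ‖genFactor lam 0 z‖ := by
    have h0 : |lam 0| ≤ L := by simpa using hn 0
    have hb : |nzPart (lam 0)| ≤ 1 + L := by
      unfold nzPart; split_ifs
      · linarith
      · simpa using hL
    have hb0 : 0 < |nzPart (lam 0)| := abs_pos.2 (nzPart_ne_zero _)
    have hz0 : ‖z‖ ≤ (1 + L) * ‖(lam 0 : ℂ) - z‖ := by
      have := norm_sub_norm_le z (lam 0 : ℂ)
      rw [norm_sub_rev, Complex.norm_real, Real.norm_eq_abs] at this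
      nlinarith [hdist 0]
    simp only [sinFactor, if_true, genFactor, norm_div, Complex.norm_real, Real.norm_eq_abs]
    rw [← mul_div_assoc, le_div_iff₀ hb0]
    calc ‖z‖ * |nzPart (lam 0)| ≤ (1 + L) * ‖(lam 0 : ℂ) - z‖ * (1 + L) := by gcongr
      _ = _ := by ring
  have hfactor : ∀ k : ℤ, k ≠ 0 → ‖sinFactor h k z‖ ≤
      Real.exp (D * ((1 + ‖z‖) / (|(k : ℝ)| * (1 + ‖(h * k : ℂ) - z‖)))) * ‖genFactor lam k z‖ := by
    intro k hk
    set b := nzPart (lam k)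
    have hb0 : 0 < |b| := abs_pos.2 (nzPart_ne_zero _)
    have hkp : 0 < |(k : ℝ)| := by positivity
    set u := ‖(lam k : ℂ) - z‖
    set v := ‖(h * k : ℂ) - z‖
    have hu1 : 1 ≤ u := hdist k
    have hv0 : 0 ≤ v := norm_nonneg _
    have huv : 1 + v ≤ (2 + L) * u := by
      have := one_add_norm_lattice_sub_le hL hn one_pos (hdist k)
      rw [div_one, ← add_assoc, one_add_one_eq_two] at this
      exact this
    have hnorm : ‖(h * k : ℂ)‖ = h * |(k : ℝ)| := by
      rw [norm_mul, Complex.norm_real, Real.norm_of_nonneg hh.le, Complex.norm_intCast]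
    have hnum : v * |b| ≤ h * |(k : ℝ)| * u + E * (1 + ‖z‖) := by
      have e : ((h * k : ℂ) - z) * (b : ℂ) = (h * k : ℂ) * ((lam k : ℂ) - z) +
          (((h * k * (b - lam k) : ℝ) : ℂ) - z * ((b - h * k : ℝ) : ℂ)) := by push_cast; ring
      have e1 : |h * k * (b - lam k)| ≤ 2 * (L + 1) := by
        by_cases hc : b = lam k
        · rw [hc, sub_self, mul_zero, abs_zero]; positivity
        · have h1 := abs_lattice_le_of_nzPart_ne hn hc
          have h2 := abs_nzPart_sub_le (lam k)
          rw [abs_mul]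
          calc _ ≤ (1 + L) * 2 := by gcongr
            _ = _ := by ring
      have e2 : |b - h * k| ≤ L + 2 := by
        have h2 := abs_nzPart_sub_le (lam k)
        have : b - h * k = (b - lam k) + (lam k - h * k) := by ring
        rw [this]
        exact (abs_add_le _ _).trans (by linarith [hn k])
      calc v * |b| = ‖((h * k : ℂ) - z) * (b : ℂ)‖ := by
            rw [norm_mul, Complex.norm_real, Real.norm_eq_abs]
        _ ≤ ‖(h * k : ℂ) * ((lam k : ℂ) - z)‖ + (‖((h * k * (b - lam k) : ℝ) : ℂ)‖ +
            ‖z * ((b - h * k : ℝ) : ℂ)‖) := by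
            rw [e]
            exact (norm_add_le _ _).trans (add_le_add le_rfl (norm_sub_le _ _))
        _ ≤ h * |(k : ℝ)| * u + (2 * (L + 1) + ‖z‖ * (L + 2)) := by
            rw [norm_mul, hnorm, norm_mul, Complex.norm_real, Complex.norm_real]
            gcongr
            · exact e1
            · exact e2
        _ ≤ _ := by simp only [E]; nlinarith
    have hE : E * (1 + ‖z‖) ≤
        D * ((1 + ‖z‖) / (|(k : ℝ)| * (1 + v))) * (h * |(k : ℝ)| * u) := by
      have : D * ((1 + ‖z‖) / (|(k : ℝ)| * (1 + v))) * (h * |(k : ℝ)| * u) =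
          E * (1 + ‖z‖) * (((2 + L) * u) / (1 + v)) := by
        simp only [D]; field_simp
      rw [this]
      refine le_mul_of_one_le_right (by positivity) ?_
      rwa [one_le_div (by positivity)]
    have hexp := Real.add_one_le_exp (D * ((1 + ‖z‖) / (|(k : ℝ)| * (1 + v))))
    simp only [sinFactor, hk, if_false, genFactor, norm_div, hnorm, Complex.norm_real,
      Real.norm_eq_abs]
    rw [← mul_div_assoc, div_le_div_iff₀ (by positivity) hb0]
    calc v * |b| ≤ (D * ((1 + ‖z‖) / (|(k : ℝ)| * (1 + v))) + 1) * (h * |(k : ℝ)| * u) := by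
          linarith
      _ ≤ Real.exp (D * ((1 + ‖z‖) / (|(k : ℝ)| * (1 + v)))) * (h * |(k : ℝ)| * u) := by gcongr
      _ = _ := by ring
  have hprod : ∀ K : ℕ, ‖∏ k ∈ Finset.Icc (-(K : ℤ)) K, sinFactor h k z‖ ≤
      B * (1 + ‖z‖) ^ (D * S) * ‖partialGen lam K z‖ := by
    intro K
    have hmem : (0 : ℤ) ∈ Finset.Icc (-(K : ℤ)) K := by simp
    unfold partialGen
    rw [norm_prod, norm_prod, ← Finset.mul_prod_erase _ _ hmem, ← Finset.mul_prod_erase _ _ hmem]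
    have h1 : ∏ k ∈ (Finset.Icc (-(K : ℤ)) K).erase 0, ‖sinFactor h k z‖ ≤
        Real.exp (D * (S * (1 + Real.log (1 + ‖z‖)))) *
          ∏ k ∈ (Finset.Icc (-(K : ℤ)) K).erase 0, ‖genFactor lam k z‖ := by
      refine (Finset.prod_le_prod (fun _ _ => norm_nonneg _)
        fun k hk => hfactor k (Finset.ne_of_mem_erase hk)).trans ?_
      rw [Finset.prod_mul_distrib, ← Real.exp_sum, ← Finset.mul_sum]
      have := HS z K
      gcongr
    have h2 : Real.exp (D * (S * (1 + Real.log (1 + ‖z‖)))) =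
        Real.exp (D * S) * (1 + ‖z‖) ^ (D * S) := by
      rw [Real.rpow_def_of_pos (by positivity), ← Real.exp_add]
      congr 1; ring
    calc _ ≤ ((1 + L) ^ 2 * ‖genFactor lam 0 z‖) * (Real.exp (D * (S * (1 + Real.log (1 + ‖z‖)))) *
          ∏ k ∈ (Finset.Icc (-(K : ℤ)) K).erase 0, ‖genFactor lam k z‖) := by gcongr
      _ = _ := by rw [h2]; simp only [B]; ring
  have hlim := le_of_tendsto_of_tendsto (tendsto_prod_sinFactor hh z).norm
    ((tendsto_partialGen hh hL hn z).norm.const_mul (B * (1 + ‖z‖) ^ (D * S)))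
    (Eventually.of_forall hprod)
  have hpi := Real.pi_pos
  rw [norm_mul, norm_div, Complex.norm_real, Complex.norm_real, Real.norm_of_nonneg hh.le,
    Real.norm_of_nonneg hpi.le] at hlim
  rw [div_mul_eq_mul_div, div_le_iff₀ hB]
  calc c₀ * (h / Real.pi) * Real.exp (Real.pi / h * |z.im|)
      = h / Real.pi * (c₀ * Real.exp (Real.pi / h * |z.im|)) := by ring
    _ ≤ h / Real.pi * ‖Complex.sin (Real.pi * (z / h))‖ := by gcongr; exact Hsin z hz
    _ ≤ _ := hlim
    _ = _ := by ring

end GeneratingFunctionLowerBound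

section ComplexAnalysis

open Filter Topology

theorem Complex.differentiable_dslope {G : ℂ → ℂ} (hG : Differentiable ℂ G) (w : ℂ) :
    Differentiable ℂ (dslope G w) := by
  have := (Complex.differentiableOn_dslope (f := G) (s := Set.univ) (c := w) univ_mem).2
    hG.differentiableOn
  exact fun z => (this z (Set.mem_univ z)).differentiableAt univ_mem

/-- An entire function vanishing at the zeros of an entire function with simple zeros is a multiple
of it. -/
theorem exists_entire_quotient {G E : ℂ → ℂ} (hG : Differentiable ℂ G) (hE : Differentiable ℂ E)
    (h0 : ∀ z, G z = 0 → deriv G z ≠ 0 ∧ E z = 0) :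
    ∃ H : ℂ → ℂ, Differentiable ℂ H ∧ ∀ z, E z = H z * G z := by
  classical
  refine ⟨fun z => if G z = 0 then deriv E z / deriv G z else E z / G z, fun w => ?_, fun z => ?_⟩
  · by_cases hw : G w = 0
    · obtain ⟨hd, hEw⟩ := h0 w hw
      have hGs : dslope G w w ≠ 0 := by rwa [dslope_same]
      have hdiff : DifferentiableAt ℂ (fun z => dslope E w z / dslope G w z) w :=
        (Complex.differentiable_dslope hE w w).div (Complex.differentiable_dslope hG w w) hGs
      refine hdiff.congr_of_eventuallyEq ?_
      have hne : ∀ᶠ z in 𝓝 w, dslope G w z ≠ 0 :=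
        (Complex.differentiable_dslope hG w).continuous.continuousAt.eventually_ne hGs
      filter_upwards [hne] with z hz
      by_cases hzw : z = w
      · subst hzw; simp [hw]
      · have hsub : z - w ≠ 0 := sub_ne_zero.2 hzw
        have e1 : (z - w) * dslope G w z = G z := by
          have := sub_smul_dslope G w z
          rwa [smul_eq_mul, hw, sub_zero] at this
        have e2 : (z - w) * dslope E w z = E z := by
          have := sub_smul_dslope E w z
          rwa [smul_eq_mul, hEw, sub_zero] at this
        have hGz : G z ≠ 0 := by rw [← e1]; exact mul_ne_zero hsub hz
        simp only [hGz, if_false]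
        rw [← e1, ← e2, mul_div_mul_left _ _ hsub]
    · have hdiff : DifferentiableAt ℂ (fun z => E z / G z) w := (hE w).div (hG w) hw
      refine hdiff.congr_of_eventuallyEq ?_
      filter_upwards [hG.continuous.continuousAt.eventually_ne hw] with z hz
      simp [hz]
  · by_cases hz : G z = 0
    · simp [hz, (h0 z hz).2]
    · simp [hz]

theorem norm_le_of_bounded_off_right_sector {H : ℂ → ℂ} (hH : Differentiable ℂ H) {s A B C : ℝ}
    (hs0 : 0 ≤ s) (hs1 : s < 1) (hB : 0 ≤ B) (hA : ∀ z, ‖H z‖ ≤ A * Real.exp (B * ‖z‖))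
    (hC : ∀ z : ℂ, s * ‖z‖ ≤ |z.im| → ‖H z‖ ≤ C) {z : ℂ} (hz : 0 ≤ z.re) : ‖H z‖ ≤ C := by
  by_cases hzs : s * ‖z‖ ≤ |z.im|
  · exact hC z hzs
  rw [not_le] at hzs
  have hA0 : 0 ≤ A := by
    have := (norm_nonneg _).trans (hA 0)
    simpa using this
  set θ := Real.arcsin ((1 + s) / 2) with hθ
  have hsin : Real.sin θ = (1 + s) / 2 := Real.sin_arcsin (by linarith) (by linarith)
  have hθ0 : 0 < θ := Real.arcsin_pos.2 (by linarith)
  have hθ1 : θ < Real.pi / 2 := Real.arcsin_lt_pi_div_two.2 (by linarith)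
  have hpi := Real.pi_pos
  set γ := θ / (Real.pi / 2) with hγ
  have hγ0 : 0 < γ := by positivity
  have hγ1 : γ < 1 := (div_lt_one (by positivity)).2 hθ1
  have hγθ : γ * (Real.pi / 2) = θ := by rw [hγ]; field_simp
  set φ : ℂ → ℂ := fun u => u ^ (γ : ℂ)
  have hφn : ∀ u, ‖φ u‖ = ‖u‖ ^ γ := fun u => Complex.norm_cpow_real u γ
  have hφle : ∀ u, ‖φ u‖ ≤ 1 + ‖u‖ := fun u => by
    rw [hφn]
    rcases le_total ‖u‖ 1 with h | h
    · have := Real.rpow_le_one (norm_nonneg u) h hγ0.le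
      have := norm_nonneg u
      linarith
    · have := Real.rpow_le_rpow_of_exponent_le h hγ1.le
      rw [Real.rpow_one] at this
      linarith
  have hφim : ∀ x : ℝ, s * ‖φ (x * Complex.I)‖ ≤ |(φ (x * Complex.I)).im| := by
    intro x
    rcases eq_or_ne x 0 with rfl | hx
    · have : φ (((0 : ℝ) : ℂ) * Complex.I) = 0 := by
        simp only [φ, Complex.ofReal_zero, zero_mul]
        exact Complex.zero_cpow (by exact_mod_cast hγ0.ne')
      rw [this]; simp
    · have hxI : (x : ℂ) * Complex.I ≠ 0 := by simp [hx]
      have e : φ (x * Complex.I) = Complex.exp (Complex.log (x * Complex.I) * γ) :=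
        Complex.cpow_def_of_ne_zero hxI _
      rw [e, Complex.exp_im, Complex.norm_exp, abs_mul, Real.abs_exp, mul_comm]
      refine mul_le_mul_of_nonneg_left ?_ (Real.exp_pos _).le
      rw [Complex.im_mul_ofReal, Complex.log_im]
      have harg : |Real.sin (Complex.arg (x * Complex.I) * γ)| = Real.sin θ := by
        have hsθ : 0 ≤ Real.sin θ := by rw [hsin]; linarith
        rcases lt_or_gt_of_ne hx with hneg | hpos
        · have : Complex.arg (x * Complex.I) = -(Real.pi / 2) := by
            have e2 : (x : ℂ) * Complex.I = ((-x : ℝ) : ℂ) * (-Complex.I) := by push_cast; ring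
            rw [e2, Complex.arg_real_mul _ (by linarith), Complex.arg_neg_I]
          rw [this, neg_mul, mul_comm, hγθ, Real.sin_neg, abs_neg, abs_of_nonneg hsθ]
        · rw [Complex.arg_real_mul _ hpos, Complex.arg_I, mul_comm, hγθ, abs_of_nonneg hsθ]
      rw [harg, hsin]
      linarith
  have hHφ : ∀ η : ℝ, 0 < η → ∀ u : ℂ, 0 ≤ u.re → ‖H (φ u)‖ * Real.exp (-(η * u.re)) ≤ C := by
    intro η hη u hu
    set f : ℂ → ℂ := fun u => H (φ u) * Complex.exp (-(η * u))
    have hfn : ∀ u, ‖f u‖ = ‖H (φ u)‖ * Real.exp (-(η * u.re)) := fun u => by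
      simp [f, Complex.norm_exp]
    rw [← hfn]
    have hfcont : ∀ w : ℂ, 0 ≤ w.re → ContinuousAt φ w := fun w hw =>
      Complex.continuousAt_cpow_const_of_re_pos (Or.inl hw) (by simpa using hγ0)
    refine PhragmenLindelof.right_half_plane_of_tendsto_zero_on_real ?_ ?_ ?_ ?_ hu
    · refine ⟨fun w hw => ?_, fun w hw => ?_⟩
      · have hw' : w ∈ Complex.slitPlane := Or.inl hw
        have h1 : DifferentiableAt ℂ φ w :=
          (hasDerivAt_id w).differentiableAt.cpow_const hw'
        have h2 : DifferentiableAt ℂ (fun u => H (φ u)) w := (hH (φ w)).comp w h1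
        exact (h2.mul (by fun_prop)).differentiableWithinAt
      · rw [Complex.closure_setOfPred_lt_re] at hw
        have h2 : ContinuousAt (fun u => H (φ u)) w :=
          hH.continuous.continuousAt.comp (hfcont w hw)
        exact (h2.mul (by fun_prop)).continuousWithinAt
    · refine ⟨1, by norm_num, B, ?_⟩
      refine Asymptotics.IsBigO.of_bound (A * Real.exp B) ?_
      filter_upwards [mem_inf_of_right (mem_principal_self _)] with w hw
      have hw' : 0 < w.re := hw
      rw [hfn, Real.rpow_one, Real.norm_of_nonneg (Real.exp_pos _).le]
      have h1 : Real.exp (-(η * w.re)) ≤ 1 := by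
        rw [Real.exp_le_one_iff]; nlinarith
      calc ‖H (φ w)‖ * Real.exp (-(η * w.re)) ≤ (A * Real.exp (B * ‖φ w‖)) * 1 := by
            gcongr
            exact hA _
        _ ≤ (A * Real.exp (B * (1 + ‖w‖))) * 1 := by
            gcongr
            exact hφle w
        _ = A * Real.exp B * Real.exp (B * ‖w‖) := by rw [mul_add, Real.exp_add]; ring_nf
    · have hη2 : 0 < η / (2 * (B + 1)) := by positivity
      have hsmall := (tendsto_rpow_neg_atTop (sub_pos.2 hγ1)).eventually (gt_mem_nhds hη2)
      have hlim : Tendsto (fun x : ℝ => A * Real.exp (-(η / 2 * x))) atTop (𝓝 0) := by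
        rw [← mul_zero A]
        refine Tendsto.const_mul A ?_
        exact Real.tendsto_exp_neg_atTop_nhds_zero.comp
          (tendsto_id.const_mul_atTop (by positivity))
      refine squeeze_zero_norm' ?_ hlim
      filter_upwards [hsmall, eventually_gt_atTop 0] with x hx hx0
      rw [hfn]
      have hxn : ‖φ (x : ℂ)‖ = x ^ γ := by
        rw [hφn, Complex.norm_real, Real.norm_of_nonneg hx0.le]
      have hBx : B * x ^ γ ≤ η / 2 * x := by
        have e1 : x ^ γ = x ^ (-(1 - γ)) * x := by
          nth_rewrite 3 [← Real.rpow_one x]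
          rw [← Real.rpow_add hx0]; congr 1; ring
        rw [e1]
        have e2 : B * (η / (2 * (B + 1))) ≤ η / 2 := by
          rw [← mul_div_assoc, div_le_div_iff₀ (by positivity) (by positivity)]
          nlinarith
        calc B * (x ^ (-(1 - γ)) * x) ≤ B * (η / (2 * (B + 1)) * x) := by gcongr
          _ = B * (η / (2 * (B + 1))) * x := by ring
          _ ≤ _ := by gcongr
      calc ‖H (φ x)‖ * Real.exp (-(η * (x : ℂ).re))
          ≤ A * Real.exp (B * ‖φ x‖) * Real.exp (-(η * (x : ℂ).re)) := by gcongr; exact hA _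
        _ ≤ A * Real.exp (η / 2 * x) * Real.exp (-(η * x)) := by
            rw [hxn, Complex.ofReal_re]; gcongr
        _ = A * Real.exp (-(η / 2 * x)) := by
            rw [mul_assoc, ← Real.exp_add]; congr 2; ring
    · intro x
      rw [hfn]
      simpa using hC _ (hφim x)
  have hz0 : z ≠ 0 := by rintro rfl; simp at hzs
  have hzn : 0 < ‖z‖ := norm_pos_iff.2 hz0
  have harg : |z.arg| ≤ θ := by
    rw [Complex.arg_of_re_nonneg hz]
    have h1 : |z.im / ‖z‖| ≤ (1 + s) / 2 := by
      rw [abs_div, abs_norm, div_le_iff₀ hzn]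
      nlinarith
    rw [abs_le] at h1 ⊢
    refine ⟨?_, Real.arcsin_le_arcsin h1.2⟩
    rw [hθ, ← Real.arcsin_neg]
    exact Real.arcsin_le_arcsin h1.1
  have hargγ : |z.arg * γ⁻¹| ≤ Real.pi / 2 := by
    rw [abs_mul, abs_of_pos (inv_pos.2 hγ0), ← div_eq_mul_inv, div_le_iff₀ hγ0, mul_comm, hγθ]
    exact harg
  set u := z ^ ((γ⁻¹ : ℝ) : ℂ) with hu
  have hlogim : (Complex.log z * ((γ⁻¹ : ℝ) : ℂ)).im = z.arg * γ⁻¹ := by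
    rw [Complex.im_mul_ofReal, Complex.log_im]
  have hure : 0 ≤ u.re := by
    rw [hu, Complex.cpow_def_of_ne_zero hz0, Complex.exp_re, hlogim]
    exact mul_nonneg (Real.exp_pos _).le (Real.cos_nonneg_of_mem_Icc (abs_le.1 hargγ))
  have hφu : φ u = z := by
    change (z ^ ((γ⁻¹ : ℝ) : ℂ)) ^ (γ : ℂ) = z
    rw [← Complex.cpow_mul, ← Complex.ofReal_mul, inv_mul_cancel₀ hγ0.ne', Complex.ofReal_one,
      Complex.cpow_one]
    · rw [hlogim]; linarith [(abs_le.1 hargγ).1]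
    · rw [hlogim]; linarith [(abs_le.1 hargγ).2]
  have hlim : Tendsto (fun η : ℝ => ‖H z‖ * Real.exp (-(η * u.re))) (𝓝[>] 0) (𝓝 ‖H z‖) := by
    refine Tendsto.mono_left ?_ nhdsWithin_le_nhds
    exact Continuous.tendsto' (by fun_prop) _ _ (by simp)
  refine le_of_tendsto hlim ?_
  filter_upwards [self_mem_nhdsWithin] with η hη
  have := hHφ η hη u hure
  rwa [hφu] at this

/-- Phragmén–Lindelöf: an entire function of exponential type which is bounded off two opposite
sectors of opening less than `π` is bounded. -/
theorem norm_le_of_bounded_off_sectors {H : ℂ → ℂ} (hH : Differentiable ℂ H) {s A B C : ℝ}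
    (hs0 : 0 ≤ s) (hs1 : s < 1) (hB : 0 ≤ B) (hA : ∀ z, ‖H z‖ ≤ A * Real.exp (B * ‖z‖))
    (hC : ∀ z : ℂ, s * ‖z‖ ≤ |z.im| → ‖H z‖ ≤ C) (z : ℂ) : ‖H z‖ ≤ C := by
  rcases le_total 0 z.re with hz | hz
  · exact norm_le_of_bounded_off_right_sector hH hs0 hs1 hB hA hC hz
  · have h := norm_le_of_bounded_off_right_sector (H := fun w => H (-w)) (A := A) (C := C)
      (by fun_prop) hs0 hs1 hB (fun w => by simpa using hA (-w))
      (fun w hw => hC (-w) (by simpa using hw)) (z := -z) (by simpa using hz)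
    simpa using h

/-- Entire functions of small exponential type with fast polynomial decay on the real line. -/
theorem exists_entire_decay {ε : ℝ} (hε : 0 < ε) (N : ℕ) :
    ∃ (h : ℂ → ℂ) (C : ℝ), Differentiable ℂ h ∧ h 0 = 1 ∧
      (∀ z, ‖h z‖ ≤ C * Real.exp (ε * ‖z‖)) ∧ ∀ x : ℝ, ‖h x‖ * (1 + |x|) ^ N ≤ C := by
  set q : ℂ → ℂ := dslope Complex.sin 0
  have hq : Differentiable ℂ q := Complex.differentiable_dslope Complex.differentiable_sin 0
  have hq0 : q 0 = 1 := by simp [q]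
  have hqne : ∀ z, z ≠ 0 → q z = Complex.sin z / z := fun z hz => by
    simp [q, dslope_of_ne _ hz, slope_def_field]
  obtain ⟨C₁, hC₁⟩ := (isCompact_closedBall (0 : ℂ) 1).exists_bound_of_continuousOn
    hq.continuous.continuousOn
  set D := max C₁ 1
  have hD1 : 1 ≤ D := le_max_right _ _
  have hsmall : ∀ z, ‖z‖ ≤ 1 → ‖q z‖ ≤ D := fun z hz =>
    (hC₁ z (mem_closedBall_zero_iff.2 hz)).trans (le_max_left _ _)
  have hsin : ∀ z : ℂ, ‖Complex.sin z‖ ≤ Real.exp ‖z‖ := by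
    intro z
    have e : Complex.sin z = (Complex.exp (-z * Complex.I) - Complex.exp (z * Complex.I)) * Complex.I / 2 := rfl
    have n1 : ‖Complex.exp (-z * Complex.I)‖ ≤ Real.exp ‖z‖ := by
      rw [Complex.norm_exp]
      refine Real.exp_le_exp.2 ?_
      simpa using (Complex.re_le_norm (-z * Complex.I))
    have n2 : ‖Complex.exp (z * Complex.I)‖ ≤ Real.exp ‖z‖ := by
      rw [Complex.norm_exp]
      refine Real.exp_le_exp.2 ?_
      simpa using (Complex.re_le_norm (z * Complex.I))
    rw [e, norm_div, norm_mul, Complex.norm_I, mul_one, Complex.norm_ofNat]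
    have := norm_sub_le (Complex.exp (-z * Complex.I)) (Complex.exp (z * Complex.I))
    linarith
  have hqexp : ∀ z, ‖q z‖ ≤ D * Real.exp ‖z‖ := by
    intro z
    have hexp1 : 1 ≤ Real.exp ‖z‖ := Real.one_le_exp (norm_nonneg z)
    rcases le_total ‖z‖ 1 with h | h
    · exact (hsmall z h).trans (le_mul_of_one_le_right (by positivity) hexp1)
    · have hz : z ≠ 0 := norm_pos_iff.1 (by linarith)
      rw [hqne z hz, norm_div]
      calc ‖Complex.sin z‖ / ‖z‖ ≤ Real.exp ‖z‖ := (div_le_self (norm_nonneg _) h).trans (hsin z)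
        _ ≤ _ := le_mul_of_one_le_left (by positivity) hD1
  have hqreal : ∀ x : ℝ, ‖q x‖ * (1 + |x|) ≤ 2 * D := by
    intro x
    rcases le_total |x| 1 with h | h
    · have := hsmall x (by simpa using h)
      nlinarith [abs_nonneg x, norm_nonneg (q x)]
    · have hx : (x : ℂ) ≠ 0 := by
        intro hc
        rw [Complex.ofReal_eq_zero.1 hc] at h
        norm_num at h
      have hx0 : 0 < |x| := by linarith
      have h1 : ‖Complex.sin x‖ ≤ 1 := by
        rw [← Complex.ofReal_sin, Complex.norm_real]; exact Real.abs_sin_le_one x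
      rw [hqne x hx, norm_div, Complex.norm_real, Real.norm_eq_abs, div_mul_eq_mul_div,
        div_le_iff₀ hx0]
      nlinarith [norm_nonneg (Complex.sin x)]
  set η := ε / (N + 1)
  have hη : 0 < η := by positivity
  have hηN : N * η ≤ ε := by
    have : (N + 1) * η = ε := by simp only [η]; field_simp
    nlinarith
  set κ := max 1 η⁻¹
  have hκ1 : 1 ≤ κ := le_max_left _ _
  have hκ : ∀ x : ℝ, 1 + |x| ≤ κ * (1 + |η * x|) := fun x => by
    have h1 : |x| = η⁻¹ * |η * x| := by
      rw [abs_mul, abs_of_pos hη, ← mul_assoc, inv_mul_cancel₀ hη.ne', one_mul]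
    have h2 : η⁻¹ ≤ κ := le_max_right _ _
    rw [h1]
    have := abs_nonneg (η * x)
    nlinarith
  refine ⟨fun z => q (η * z) ^ N, (κ * (2 * D)) ^ N, by fun_prop, by simp [hq0], fun z => ?_,
    fun x => ?_⟩
  · rw [norm_pow]
    have hηz : ‖(η : ℂ) * z‖ = η * ‖z‖ := by
      rw [norm_mul, Complex.norm_real, Real.norm_of_nonneg hη.le]
    calc ‖q (η * z)‖ ^ N ≤ (D * Real.exp (η * ‖z‖)) ^ N := by
          have := hqexp (η * z)
          rw [hηz] at this
          gcongr
      _ = D ^ N * Real.exp (N * (η * ‖z‖)) := by rw [mul_pow, ← Real.exp_nat_mul]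
      _ ≤ (κ * (2 * D)) ^ N * Real.exp (ε * ‖z‖) := by
          have h1 : N * (η * ‖z‖) ≤ ε * ‖z‖ := by
            rw [← mul_assoc]
            exact mul_le_mul_of_nonneg_right hηN (norm_nonneg z)
          have h2 : D ≤ κ * (2 * D) := by nlinarith
          gcongr
  · rw [norm_pow, ← mul_pow]
    have h1 := hqreal (η * x)
    push_cast at h1
    have h2 := hκ x
    have h3 : 0 ≤ ‖q (η * x)‖ := norm_nonneg _
    refine pow_le_pow_left₀ (by positivity) ?_ N
    calc ‖q (η * x)‖ * (1 + |x|) ≤ ‖q (η * x)‖ * (κ * (1 + |η * x|)) := by gcongr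
      _ = κ * (‖q (η * x)‖ * (1 + |η * x|)) := by ring
      _ ≤ κ * (2 * D) := by gcongr

end ComplexAnalysis

section Interpolation

open Filter Topology

variable {h L δ : ℝ} {lam : ℤ → ℝ}

theorem one_add_pow_le_exp {κ t : ℝ} (hκ : 0 < κ) (M : ℕ) (ht : 0 ≤ t) :
    (1 + t) ^ M ≤ (1 + (M + 1) / κ) ^ M * Real.exp (κ * t) := by
  set η := κ / (M + 1) with hη'
  have hη : 0 < η := by positivity
  have h1 : 1 + t ≤ (1 + (M + 1) / κ) * Real.exp (η * t) := by
    have e1 : 1 ≤ Real.exp (η * t) := Real.one_le_exp (by positivity)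
    have e2 : η * t ≤ Real.exp (η * t) := by linarith [Real.add_one_le_exp (η * t)]
    have e3 : t = (M + 1) / κ * (η * t) := by rw [hη']; field_simp
    have e4 : (M + 1) / κ * (η * t) ≤ (M + 1) / κ * Real.exp (η * t) := by gcongr
    linarith
  calc (1 + t) ^ M ≤ ((1 + (M + 1) / κ) * Real.exp (η * t)) ^ M := by gcongr
    _ = (1 + (M + 1) / κ) ^ M * Real.exp (M * (η * t)) := by rw [mul_pow, ← Real.exp_nat_mul]
    _ ≤ _ := by
      have : M * (η * t) ≤ κ * t := by
        have : κ * t = (M + 1) * (η * t) := by rw [hη']; field_simp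
        have : 0 ≤ η * t := by positivity
        linarith
      gcongr

theorem exists_nat_le_norm_genFun (hh : 0 < h) (hL : 0 ≤ L) :
    ∃ (c : ℝ) (M : ℕ), 0 < c ∧ ∀ lam : ℤ → ℝ, (∀ k : ℤ, |lam k - h * k| ≤ L) → ∀ z : ℂ,
      1 ≤ |z.im| → c * Real.exp (Real.pi / h * |z.im|) ≤ (1 + ‖z‖) ^ M * ‖genFun lam z‖ := by
  obtain ⟨c, M, hc, hM, H⟩ := exists_le_norm_genFun hh hL
  refine ⟨c, ⌈M⌉₊, hc, fun lam hn z hz => (H lam hn z hz).trans ?_⟩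
  gcongr
  rw [← Real.rpow_natCast]
  exact Real.rpow_le_rpow_of_exponent_le (by linarith [norm_nonneg z]) (Nat.le_ceil M)

/-- Lower bound for the generating function at points at distance at least `r` from its zeros. -/
theorem exists_one_le_norm_genFun (hh : 0 < h) (hL : 0 ≤ L) {r : ℝ} (hr : 0 < r) :
    ∃ (K : ℝ) (M : ℕ), 0 < K ∧ ∀ lam : ℤ → ℝ, (∀ k : ℤ, |lam k - h * k| ≤ L) → ∀ z : ℂ,
      (∀ k, r ≤ ‖(lam k : ℂ) - z‖) → 1 ≤ K * (1 + ‖z‖) ^ M * ‖genFun lam z‖ := by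
  obtain ⟨c, M, hc, H⟩ := exists_nat_le_norm_genFun hh hL
  obtain ⟨C, hC, HV⟩ := exists_norm_genFun_vertical_le hh hL hr
  have hpos : 0 ≤ Real.pi / h := div_nonneg Real.pi_pos.le hh.le
  refine ⟨max 1 C * 2 ^ M / c, M, by positivity, fun lam hn z hz => ?_⟩
  have hlow : ∀ w : ℂ, 1 ≤ |w.im| → c ≤ (1 + ‖w‖) ^ M * ‖genFun lam w‖ := fun w hw => by
    refine le_trans ?_ (H lam hn w hw)
    exact le_mul_of_one_le_right hc.le (Real.one_le_exp (by positivity))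
  have e : max 1 C * 2 ^ M / c * (1 + ‖z‖) ^ M * ‖genFun lam z‖ =
      (max 1 C * (2 * (1 + ‖z‖)) ^ M * ‖genFun lam z‖) / c := by rw [mul_pow]; ring
  rw [e, one_le_div hc]
  have hz0 := norm_nonneg z
  rcases le_total 1 |z.im| with hi | hi
  · calc c ≤ (1 + ‖z‖) ^ M * ‖genFun lam z‖ := hlow z hi
      _ ≤ 1 * (2 * (1 + ‖z‖)) ^ M * ‖genFun lam z‖ := by
        rw [one_mul]; gcongr; linarith
      _ ≤ _ := by gcongr; exact le_max_left _ _
  · set w : ℂ := z.re + Complex.I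
    have hwn : ‖w‖ ≤ ‖z‖ + 1 := by
      refine (norm_add_le _ _).trans ?_
      rw [Complex.norm_real, Complex.norm_I]
      exact add_le_add (Complex.abs_re_le_norm z) le_rfl
    have h1 := hlow w (by simp [w])
    have h2 := HV lam hn z w (by simp [w]) (by simp [w]) hz
    calc c ≤ (1 + ‖w‖) ^ M * ‖genFun lam w‖ := h1
      _ ≤ (2 * (1 + ‖z‖)) ^ M * (C * ‖genFun lam z‖) := by
        gcongr; linarith
      _ = C * (2 * (1 + ‖z‖)) ^ M * ‖genFun lam z‖ := by ring
      _ ≤ _ := by gcongr; exact le_max_right _ _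

theorem exists_one_le_norm_deriv_genFun (hh : 0 < h) (hL : 0 ≤ L) (hδ : 0 < δ) :
    ∃ (K : ℝ) (M : ℕ), 0 < K ∧ ∀ lam : ℤ → ℝ, (∀ k : ℤ, |lam k - h * k| ≤ L) →
      (∀ k l, k ≠ l → δ ≤ |lam k - lam l|) → ∀ n : ℤ,
        1 ≤ K * (1 + |lam n|) ^ M * ‖deriv (genFun lam) (lam n)‖ := by
  obtain ⟨K, M, hK, H⟩ := exists_one_le_norm_genFun hh hL one_pos
  obtain ⟨C, hC, HD⟩ := exists_norm_genFun_le_deriv hh hL hδ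
  refine ⟨K * 2 ^ M * C, M, by positivity, fun lam hn hsep n => ?_⟩
  have hw : ‖(lam n : ℂ) + Complex.I‖ ≤ |lam n| + 1 := by
    refine (norm_add_le _ _).trans ?_
    rw [Complex.norm_real, Complex.norm_I, Real.norm_eq_abs]
  have h1 := H lam hn (lam n + Complex.I) fun k => by
    have := Complex.abs_im_le_norm ((lam k : ℂ) - (lam n + Complex.I))
    simpa using this
  have h0 := abs_nonneg (lam n)
  calc 1 ≤ K * (1 + ‖(lam n : ℂ) + Complex.I‖) ^ M * ‖genFun lam (lam n + Complex.I)‖ := h1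
    _ ≤ K * (2 * (1 + |lam n|)) ^ M * (C * ‖deriv (genFun lam) (lam n)‖) := by
      gcongr
      · linarith
      · exact HD lam hn hsep n
    _ = _ := by rw [mul_pow]; ring

theorem exists_nearest (hsep : ∀ k l, k ≠ l → δ ≤ |lam k - lam l|) (z : ℂ) :
    ∃ n : ℤ, ∀ k, k ≠ n → δ / 2 ≤ ‖(lam k : ℂ) - z‖ := by
  by_cases hex : ∃ n, ‖(lam n : ℂ) - z‖ < δ / 2
  · obtain ⟨n, hn⟩ := hex
    refine ⟨n, fun k hk => ?_⟩
    have h1 := hsep k n hk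
    have h2 : |lam k - lam n| ≤ ‖(lam k : ℂ) - z‖ + ‖(lam n : ℂ) - z‖ := by
      have : ((lam k - lam n : ℝ) : ℂ) = ((lam k : ℂ) - z) - ((lam n : ℂ) - z) := by push_cast; ring
      rw [← Real.norm_eq_abs, ← Complex.norm_real, this]
      exact norm_sub_le _ _
    linarith
  · push Not at hex
    exact ⟨0, fun k _ => hex k⟩

theorem exists_eq_of_genFun_eq_zero (hh : 0 < h) (hL : 0 ≤ L) (hδ : 0 < δ)
    (hn : ∀ k : ℤ, |lam k - h * k| ≤ L) (hsep : ∀ k l, k ≠ l → δ ≤ |lam k - lam l|) {z : ℂ}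
    (hz : genFun lam z = 0) : ∃ n, z = lam n := by
  obtain ⟨n, hn'⟩ := exists_nearest hsep z
  by_contra hne
  push Not at hne
  have hpos : 0 < ‖(lam n : ℂ) - z‖ := norm_pos_iff.2 (sub_ne_zero.2 (hne n).symm)
  obtain ⟨K, M, hK, H⟩ := exists_one_le_norm_genFun hh hL (lt_min (half_pos hδ) hpos)
  have := H lam hn z fun k => by
    rcases eq_or_ne k n with rfl | hk
    · exact min_le_right _ _
    · exact (min_le_left _ _).trans (hn' k hk)
  rw [hz, norm_zero, mul_zero] at this
  linarith

theorem exists_norm_dslope_le {G : ℂ → ℂ} (hG : Differentiable ℂ G) (R : ℝ) :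
    ∃ B : ℝ, 0 ≤ B ∧ ∀ w z, G w = 0 → ‖z‖ ≤ R → ‖dslope G w z‖ ≤ B := by
  obtain ⟨B, hB⟩ := (isCompact_closedBall (0 : ℂ) (R + 2)).exists_bound_of_continuousOn
    hG.continuous.continuousOn
  refine ⟨max B 0, le_max_right _ _, fun w z hw hz => ?_⟩
  have hoff : ∀ v, 1 ≤ ‖v - w‖ → ‖v‖ ≤ R + 2 → ‖dslope G w v‖ ≤ max B 0 := fun v hv hvR => by
    have h1 := sub_smul_dslope G w v
    rw [hw, sub_zero, smul_eq_mul] at h1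
    have h2 : ‖G v‖ ≤ max B 0 := (hB v (mem_closedBall_zero_iff.2 hvR)).trans (le_max_left _ _)
    rw [← h1, norm_mul] at h2
    nlinarith [norm_nonneg (dslope G w v)]
  rcases le_total 1 ‖z - w‖ with hc | hc
  · exact hoff z hc (by linarith)
  · refine Complex.norm_le_of_forall_mem_frontier_norm_le (U := Metric.ball w 1) Metric.isBounded_ball
      (Complex.differentiable_dslope hG w).diffContOnCl (fun v hv => ?_) ?_
    · rw [frontier_ball w one_ne_zero, mem_sphere_iff_norm] at hv
      refine hoff v hv.ge ?_
      have : v = (v - w) - (z - w) + z := by ring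
      rw [this]
      refine (norm_add_le _ _).trans ?_
      have := norm_sub_le (v - w) (z - w)
      linarith
    · rw [closure_ball w one_ne_zero, mem_closedBall_iff_norm]; exact hc

theorem differentiable_tsum_mul_dslope {G : ℂ → ℂ} (hG : Differentiable ℂ G) {d w : ℤ → ℂ}
    (hd : Summable fun n => ‖d n‖) (hw : ∀ n, G (w n) = 0) :
    Differentiable ℂ fun z => ∑' n, d n * dslope G (w n) z := by
  intro z
  obtain ⟨B, hB0, hB⟩ := exists_norm_dslope_le hG (‖z‖ + 1)
  have := Complex.differentiableOn_tsum_of_summable_norm (U := Metric.ball (0 : ℂ) (‖z‖ + 1))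
    (F := fun n z => d n * dslope G (w n) z) (hd.mul_right B)
    (fun n => ((Complex.differentiable_dslope hG (w n)).const_mul _).differentiableOn)
    Metric.isOpen_ball fun n v hv => by
      rw [norm_mul]
      gcongr
      exact hB _ _ (hw n) (mem_ball_zero_iff.1 hv).le
  exact this.differentiableAt (Metric.isOpen_ball.mem_nhds (mem_ball_zero_iff.2 (lt_add_one ‖z‖)))

/-- Lagrange interpolation of an entire function of exponential type `τ < π / h` at the points of a
separated sequence close to the lattice `h ℤ`. -/
theorem eq_tsum_interpolation (hh : 0 < h) (hL : 0 ≤ L) (hδ : 0 < δ)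
    (hn : ∀ k : ℤ, |lam k - h * k| ≤ L) (hsep : ∀ k l, k ≠ l → δ ≤ |lam k - lam l|)
    {u : ℂ → ℂ} (hu : Differentiable ℂ u) {K τ : ℝ} (hτ0 : 0 < τ) (hτ : τ < Real.pi / h)
    (hK : ∀ z, ‖u z‖ ≤ K * Real.exp (τ * ‖z‖))
    (hd : Summable fun n => ‖u (lam n) / deriv (genFun lam) (lam n)‖) (z : ℂ) :
    u z = ∑' n, u (lam n) / deriv (genFun lam) (lam n) * dslope (genFun lam) (lam n) z := by
  set G := genFun lam
  have hG : Differentiable ℂ G := differentiable_genFun hh hL hn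
  have hGz : ∀ n, G (lam n) = 0 := genFun_apply_self hh hL hn
  set d : ℤ → ℂ := fun n => u (lam n) / deriv G (lam n)
  set T : ℂ → ℂ := fun z => ∑' n, d n * dslope G (lam n) z
  have hT : Differentiable ℂ T := differentiable_tsum_mul_dslope hG hd hGz
  have hinj : ∀ k l, k ≠ l → (lam k : ℂ) ≠ lam l := fun k l hkl hc => by
    have h1 := hsep k l hkl
    rw [Complex.ofReal_injective hc, sub_self, abs_zero] at h1
    linarith
  have hGd : ∀ n, deriv G (lam n) ≠ 0 := by
    obtain ⟨K', M', hK', H'⟩ := exists_one_le_norm_deriv_genFun hh hL hδ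
    intro n hc
    have := H' lam hn hsep n
    rw [show deriv (genFun lam) (lam n) = 0 from hc, norm_zero, mul_zero] at this
    linarith
  have hK0 : 0 ≤ K := by
    have := (norm_nonneg _).trans (hK 0)
    simpa using this
  have hTn : ∀ n, T (lam n) = u (lam n) := by
    intro n
    change ∑' m, d m * dslope G (lam m) (lam n) = _
    rw [tsum_eq_single n]
    · rw [dslope_same]; exact div_mul_cancel₀ _ (hGd n)
    · intro m hm
      rw [dslope_of_ne _ (hinj n m hm.symm), slope_def_field, hGz, hGz]; simp
  obtain ⟨H, hH, hE⟩ := exists_entire_quotient hG (hu.sub hT) fun v hv => by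
    obtain ⟨n, rfl⟩ := exists_eq_of_genFun_eq_zero hh hL hδ hn hsep hv
    exact ⟨hGd n, by simp [hTn]⟩
  set D := ∑' n, ‖d n‖
  have hD : 0 ≤ D := tsum_nonneg fun _ => norm_nonneg _
  have hHbound : ∀ (r : ℝ) (v : ℂ), 0 < r → (∀ k, r ≤ ‖(lam k : ℂ) - v‖) → G v ≠ 0 →
      ‖H v‖ ≤ ‖u v‖ / ‖G v‖ + D / r := by
    intro r v hr hv hGv
    have e1 : H v = u v / G v - T v / G v := by
      rw [← sub_div, eq_div_iff hGv]; exact (hE v).symm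
    have hslope : ∀ n, ‖dslope G (lam n) v‖ ≤ ‖G v‖ / r := fun n => by
      have h1 := sub_smul_dslope G (lam n) v
      rw [hGz, sub_zero, smul_eq_mul] at h1
      rw [le_div_iff₀ hr, ← h1, norm_mul, mul_comm, norm_sub_rev]
      gcongr
      exact hv n
    have hsum : Summable fun n => ‖d n‖ * (‖G v‖ / r) := hd.mul_right _
    have e2 : ‖T v‖ ≤ D * (‖G v‖ / r) := by
      rw [← tsum_mul_right]
      refine tsum_of_norm_bounded hsum.hasSum fun n => ?_
      rw [norm_mul]
      gcongr
      exact hslope n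
    have hGp : 0 < ‖G v‖ := norm_pos_iff.2 hGv
    rw [e1]
    refine (norm_sub_le _ _).trans ?_
    rw [norm_div, norm_div]
    refine add_le_add le_rfl ?_
    rw [div_le_iff₀ hGp]
    refine e2.trans (le_of_eq ?_)
    ring
  have hδ4 : 0 < δ / 4 := by positivity
  obtain ⟨K₁, M₁, hK₁, H₁⟩ := exists_one_le_norm_genFun hh hL hδ4
  set B := τ + M₁
  set A := K * K₁ + D / (δ / 4)
  have hB0 : 0 ≤ B := by positivity
  have hA0 : 0 ≤ A := by positivity
  have hoff : ∀ v, (∀ k, δ / 4 ≤ ‖(lam k : ℂ) - v‖) → ‖H v‖ ≤ A * Real.exp (B * ‖v‖) := by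
    intro v hv
    have h1 := H₁ lam hn v hv
    have hGv : G v ≠ 0 := fun hc => by
      rw [show genFun lam v = 0 from hc, norm_zero, mul_zero] at h1
      linarith
    have hGp : 0 < ‖G v‖ := norm_pos_iff.2 hGv
    refine (hHbound _ v hδ4 hv hGv).trans ?_
    have h2 : ‖u v‖ / ‖G v‖ ≤ K * K₁ * Real.exp (B * ‖v‖) := by
      rw [div_le_iff₀ hGp]
      have h3 : (1 + ‖v‖) ^ M₁ ≤ Real.exp (M₁ * ‖v‖) := by
        rw [Real.exp_nat_mul]
        have := Real.add_one_le_exp ‖v‖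
        gcongr
        linarith
      calc ‖u v‖ ≤ K * Real.exp (τ * ‖v‖) * 1 := by rw [mul_one]; exact hK v
        _ ≤ K * Real.exp (τ * ‖v‖) * (K₁ * (1 + ‖v‖) ^ M₁ * ‖G v‖) := by gcongr
        _ ≤ K * Real.exp (τ * ‖v‖) * (K₁ * Real.exp (M₁ * ‖v‖) * ‖G v‖) := by gcongr
        _ = _ := by simp only [B]; rw [add_mul, Real.exp_add]; ring
    have h4 : D / (δ / 4) ≤ D / (δ / 4) * Real.exp (B * ‖v‖) :=
      le_mul_of_one_le_right (by positivity) (Real.one_le_exp (by positivity))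
    calc _ ≤ K * K₁ * Real.exp (B * ‖v‖) + D / (δ / 4) * Real.exp (B * ‖v‖) := add_le_add h2 h4
      _ = _ := by simp only [A]; ring
  have hall : ∀ v, ‖H v‖ ≤ A * Real.exp (B * (δ / 2)) * Real.exp (B * ‖v‖) := by
    intro v
    rw [mul_assoc, ← Real.exp_add]
    by_cases hv : ∀ k, δ / 4 ≤ ‖(lam k : ℂ) - v‖
    · refine (hoff v hv).trans ?_
      gcongr
      have : 0 ≤ B * (δ / 2) := by positivity
      linarith
    · push Not at hv
      obtain ⟨n, hnv⟩ := hv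
      refine Complex.norm_le_of_forall_mem_frontier_norm_le (U := Metric.ball (lam n : ℂ) (δ / 4))
        Metric.isBounded_ball hH.diffContOnCl (fun w hw => ?_) ?_
      · rw [frontier_ball _ hδ4.ne', mem_sphere_iff_norm] at hw
        have hwv : ‖w‖ ≤ δ / 2 + ‖v‖ := by
          have : w = (w - lam n) + ((lam n : ℂ) - v) + v := by ring
          rw [this]
          refine (norm_add_le _ _).trans ?_
          have := norm_add_le (w - lam n) ((lam n : ℂ) - v)
          linarith
        refine (hoff w fun k => ?_).trans ?_
        · rcases eq_or_ne k n with rfl | hk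
          · rw [norm_sub_rev, hw]
          · have h1 := hsep k n hk
            have h2 : |lam k - lam n| ≤ ‖(lam k : ℂ) - w‖ + ‖w - lam n‖ := by
              have : ((lam k - lam n : ℝ) : ℂ) = ((lam k : ℂ) - w) + (w - lam n) := by
                push_cast; ring
              rw [← Real.norm_eq_abs, ← Complex.norm_real, this]
              exact norm_add_le _ _
            linarith
        · rw [← mul_add]
          gcongr
      · rw [closure_ball _ hδ4.ne', mem_closedBall_iff_norm, norm_sub_rev]; exact hnv.le
  obtain ⟨c, M, hc, HL⟩ := exists_nat_le_norm_genFun hh hL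
  set a := Real.pi / h
  have ha0 : 0 < a := hτ0.trans hτ
  set s := (τ / a + 1) / 2 with hs
  have hτa : τ / a < 1 := (div_lt_one ha0).2 hτ
  have hτa0 : 0 < τ / a := by positivity
  have hs0 : 0 < s := by positivity
  have hs1 : s < 1 := by linarith
  set κ := s * a - τ with hκ'
  have hκ : 0 < κ := by
    have : s * a = (τ + a) / 2 := by rw [hs]; field_simp
    linarith
  set Q := K * (1 + (M + 1) / (κ / 2)) ^ M / c
  have hQ : 0 ≤ Q := by positivity
  have hfar : ∀ v : ℂ, 1 ≤ |v.im| → s * ‖v‖ ≤ |v.im| →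
      ‖H v‖ ≤ Q * Real.exp (-(κ / 2 * ‖v‖)) + D / |v.im| := by
    intro v hv1 hvs
    have h1 := HL lam hn v hv1
    have hGp : 0 < ‖G v‖ := by
      by_contra hcon
      have : ‖genFun lam v‖ = 0 := le_antisymm (not_lt.1 hcon) (norm_nonneg _)
      rw [this, mul_zero] at h1
      have := Real.exp_pos (a * |v.im|)
      nlinarith
    refine (hHbound |v.im| v (by linarith) (fun k => ?_) (norm_pos_iff.1 hGp)).trans ?_
    · have := Complex.abs_im_le_norm ((lam k : ℂ) - v)
      simpa using this
    refine add_le_add ?_ le_rfl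
    rw [div_le_iff₀ hGp]
    have h2 := one_add_pow_le_exp (half_pos hκ) M (norm_nonneg v)
    have h3 : c * Real.exp (a * (s * ‖v‖)) ≤ (1 + ‖v‖) ^ M * ‖G v‖ := by
      refine le_trans ?_ h1
      gcongr
    have h4 : c * Real.exp (a * (s * ‖v‖)) ≤
        (1 + (M + 1) / (κ / 2)) ^ M * Real.exp (κ / 2 * ‖v‖) * ‖G v‖ :=
      h3.trans (by gcongr)
    have h5 : Real.exp (τ * ‖v‖) =
        Real.exp (a * (s * ‖v‖)) * Real.exp (-(κ / 2 * ‖v‖)) * Real.exp (-(κ / 2 * ‖v‖)) := by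
      rw [← Real.exp_add, ← Real.exp_add]; congr 1; rw [hκ']; ring
    calc ‖u v‖ ≤ K * Real.exp (τ * ‖v‖) := hK v
      _ = K / c * (c * Real.exp (a * (s * ‖v‖))) * (Real.exp (-(κ / 2 * ‖v‖)) *
          Real.exp (-(κ / 2 * ‖v‖))) := by rw [h5]; field_simp
      _ ≤ K / c * ((1 + (M + 1) / (κ / 2)) ^ M * Real.exp (κ / 2 * ‖v‖) * ‖G v‖) *
          (Real.exp (-(κ / 2 * ‖v‖)) * Real.exp (-(κ / 2 * ‖v‖))) := by gcongr
      _ = Q * (Real.exp (κ / 2 * ‖v‖) * Real.exp (-(κ / 2 * ‖v‖))) *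
          Real.exp (-(κ / 2 * ‖v‖)) * ‖G v‖ := by simp only [Q]; ring
      _ = _ := by rw [← Real.exp_add, add_neg_cancel, Real.exp_zero, mul_one]
  set C := max (Q + D) (A * Real.exp (B * (δ / 2)) * Real.exp (B * (1 / s)))
  have hbdd : ∀ v, ‖H v‖ ≤ C := by
    refine norm_le_of_bounded_off_sectors hH hs0.le hs1 hB0 hall fun v hv => ?_
    rcases le_total 1 |v.im| with hi | hi
    · refine (hfar v hi hv).trans (le_trans ?_ (le_max_left _ _))
      refine add_le_add (mul_le_of_le_one_right hQ ?_) (div_le_self hD hi)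
      rw [Real.exp_le_one_iff]
      have : 0 ≤ κ / 2 * ‖v‖ := by positivity
      linarith
    · refine (hall v).trans (le_trans ?_ (le_max_right _ _))
      gcongr
      rw [le_div_iff₀ hs0]
      linarith
  have hH0 : ∀ v, H v = 0 := by
    intro v
    have hconst : ∀ y : ℝ, H v = H (y * Complex.I) := fun y =>
      hH.apply_eq_apply_of_bounded (isBounded_iff_forall_norm_le.2
        ⟨C, by rintro _ ⟨w, rfl⟩; exact hbdd w⟩) _ _
    have hlim : Tendsto (fun y : ℝ => Q * Real.exp (-(κ / 2 * y)) + D / y) atTop (𝓝 0) := by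
      have h1 : Tendsto (fun y : ℝ => Q * Real.exp (-(κ / 2 * y))) atTop (𝓝 (Q * 0)) :=
        Tendsto.const_mul Q (Real.tendsto_exp_neg_atTop_nhds_zero.comp
          (tendsto_id.const_mul_atTop (by positivity)))
      have h2 : Tendsto (fun y : ℝ => D / y) atTop (𝓝 0) := tendsto_id.const_div_atTop D
      simpa using h1.add h2
    refine norm_le_zero_iff.1 (ge_of_tendsto hlim ?_)
    filter_upwards [eventually_ge_atTop 1] with y hy
    have hy0 : 0 ≤ y := by linarith
    have := hfar (y * Complex.I) (by simp [abs_of_nonneg hy0, hy])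
      (by simp [abs_of_nonneg hy0]; nlinarith)
    rw [hconst y]
    simpa [abs_of_nonneg hy0] using this
  have := hE z
  rw [hH0, zero_mul] at this
  exact sub_eq_zero.1 this

/-- The value at the origin of an entire function of exponential type is controlled by its values
on a separated near-lattice sequence of supercritical density. -/
theorem exists_norm_zero_le_sampling {σ : ℝ} (hh : 0 < h) (hL : 0 ≤ L) (hδ : 0 < δ) (hσ : 0 < σ)
    (hσh : σ < Real.pi / h) (N : ℕ) :
    ∃ C : ℝ, 0 < C ∧ ∀ lam : ℤ → ℝ, (∀ k : ℤ, |lam k - h * k| ≤ L) →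
      (∀ k l, k ≠ l → δ ≤ |lam k - lam l|) → ∀ g : ℂ → ℂ, Differentiable ℂ g →
      (∀ ε : ℝ, 0 < ε → ∃ c : ℝ, ∀ z, ‖g z‖ ≤ c * Real.exp ((σ + ε) * ‖z‖)) →
      ∀ A : ℝ, 0 ≤ A → (∀ n, ‖g (lam n)‖ ≤ A * (1 + |lam n|) ^ N) → ‖g 0‖ ≤ C * A := by
  set ε := (Real.pi / h - σ) / 4 with hε'
  have hε : 0 < ε := by rw [hε']; linarith
  obtain ⟨K, M, hK, HD⟩ := exists_one_le_norm_deriv_genFun hh hL hδ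
  obtain ⟨φ, Cφ, hφ, hφ0, hφexp, hφdec⟩ := exists_entire_decay hε (N + M + 2)
  obtain ⟨S, hS0, HS⟩ := exists_sum_lattice_inv_sq_le hh
  have hCφ : 0 ≤ Cφ := by
    have := (norm_nonneg _).trans (hφexp 0)
    simpa using this
  set C := K * Cφ * (1 + L) ^ 2 * S
  have hC : 0 ≤ C := by positivity
  refine ⟨C + 1, by positivity, fun lam hn hsep g hg hgexp A hA hgA => ?_⟩
  by_cases hzero : ∃ n, lam n = 0
  · obtain ⟨n, hn0⟩ := hzero
    have := hgA n
    rw [hn0] at this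
    simp at this
    nlinarith
  push Not at hzero
  set u : ℂ → ℂ := fun z => g z * φ z
  obtain ⟨c, hc⟩ := hgexp ε hε
  have hc0 : 0 ≤ c := by
    have := (norm_nonneg _).trans (hc 0)
    simpa using this
  have hu : ∀ z, ‖u z‖ ≤ c * Cφ * Real.exp ((σ + 2 * ε) * ‖z‖) := fun z => by
    rw [norm_mul]
    calc ‖g z‖ * ‖φ z‖ ≤ (c * Real.exp ((σ + ε) * ‖z‖)) * (Cφ * Real.exp (ε * ‖z‖)) := by
          gcongr
          · exact hc z
          · exact hφexp z
      _ = c * Cφ * (Real.exp ((σ + ε) * ‖z‖) * Real.exp (ε * ‖z‖)) := by ring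
      _ = _ := by rw [← Real.exp_add]; congr 2; ring
  set d : ℤ → ℂ := fun n => u (lam n) / deriv (genFun lam) (lam n)
  have hdn : ∀ n, ‖d n‖ ≤ A * (K * Cφ * (1 + L) ^ 2) * ((1 + |h * n - 0|) ^ 2)⁻¹ := by
    intro n
    have h1 := HD lam hn hsep n
    have hpos : 0 < ‖deriv (genFun lam) (lam n)‖ := by
      by_contra hcon
      rw [le_antisymm (not_lt.1 hcon) (norm_nonneg _), mul_zero] at h1
      linarith
    set x := 1 + |lam n| with hx
    have hx0 : 0 < x := by positivity
    have h2 : 1 + |h * n - 0| ≤ (1 + L) * x := by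
      have := abs_sub_abs_le_abs_sub (h * n) (lam n)
      rw [abs_sub_comm (h * n)] at this
      have h3 := hn n
      have := abs_nonneg (lam n)
      rw [sub_zero, hx]
      nlinarith
    have h4 : ‖φ (lam n)‖ * x ^ (N + M + 2) ≤ Cφ := hφdec (lam n)
    rw [norm_div, norm_mul, div_le_iff₀ hpos, ← div_eq_mul_inv, div_mul_eq_mul_div,
      le_div_iff₀ (by positivity)]
    calc ‖g (lam n)‖ * ‖φ (lam n)‖ * (1 + |h * n - 0|) ^ 2
        ≤ (A * x ^ N) * ‖φ (lam n)‖ * ((1 + L) * x) ^ 2 * 1 := by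
          rw [mul_one]
          gcongr
          exact hgA n
      _ ≤ (A * x ^ N) * ‖φ (lam n)‖ * ((1 + L) * x) ^ 2 *
          (K * x ^ M * ‖deriv (genFun lam) (lam n)‖) := by gcongr
      _ = A * K * (1 + L) ^ 2 * (‖φ (lam n)‖ * x ^ (N + M + 2)) *
          ‖deriv (genFun lam) (lam n)‖ := by ring
      _ ≤ A * K * (1 + L) ^ 2 * Cφ * ‖deriv (genFun lam) (lam n)‖ := by gcongr
      _ = _ := by ring
  have hfin : ∀ F : Finset ℤ, ∑ n ∈ F, ‖d n‖ ≤ C * A := by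
    intro F
    calc ∑ n ∈ F, ‖d n‖ ≤ ∑ n ∈ F, A * (K * Cφ * (1 + L) ^ 2) * ((1 + |h * n - 0|) ^ 2)⁻¹ :=
          Finset.sum_le_sum fun n _ => hdn n
      _ = A * (K * Cφ * (1 + L) ^ 2) * ∑ n ∈ F, ((1 + |h * n - 0|) ^ 2)⁻¹ := by
          rw [Finset.mul_sum]
      _ ≤ A * (K * Cφ * (1 + L) ^ 2) * S := by
          gcongr
          exact HS 0 F
      _ = C * A := by ring
  have hsum : Summable fun n => ‖d n‖ :=
    summable_of_sum_le (fun _ => norm_nonneg _) hfin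
  have key := eq_tsum_interpolation hh hL hδ hn hsep (u := u) (hg.mul hφ) (τ := σ + 2 * ε) (by linarith)
    (by rw [hε']; linarith) hu hsum 0
  have h0 : g 0 = ∑' n, d n * dslope (genFun lam) (lam n) 0 := by
    rw [← key]; simp [u, hφ0]
  have hle : ‖g 0‖ ≤ ∑' n, ‖d n‖ := by
    rw [h0]
    refine tsum_of_norm_bounded hsum.hasSum fun n => ?_
    rw [norm_mul]
    refine mul_le_of_le_one_right (norm_nonneg _) ?_
    have hne : (0 : ℂ) ≠ lam n := fun hc => hzero n (by exact_mod_cast hc.symm)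
    have h1 := sub_smul_dslope (genFun lam) (lam n) 0
    rw [genFun_apply_self hh hL hn, sub_zero, zero_sub, smul_eq_mul] at h1
    have h2 := norm_genFun_zero_le hh hL hn n
    rw [← h1, norm_mul, norm_neg, Complex.norm_real, Real.norm_eq_abs] at h2
    exact le_of_mul_le_mul_left (by linarith) (abs_pos.2 (hzero n))
  calc ‖g 0‖ ≤ ∑' n, ‖d n‖ := hle
    _ ≤ C * A := hsum.tsum_le_of_sum_le hfin
    _ ≤ (C + 1) * A := by gcongr; linarith

end Interpolation

section OneDimensionalSampling

open MeasureTheory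

/-- Entire functions on `ℂ` of exponential type at most `σ`. -/
structure IsExpType (σ : ℝ) (g : ℂ → ℂ) : Prop where
  differentiable : Differentiable ℂ g
  bound : ∀ ε : ℝ, 0 < ε → ∃ c : ℝ, ∀ z, ‖g z‖ ≤ c * Real.exp ((σ + ε) * ‖z‖)

theorem IsExpType.comp_add {σ : ℝ} (hσ : 0 < σ) {g : ℂ → ℂ} (hg : IsExpType σ g) (x : ℂ) :
    IsExpType σ fun z => g (z + x) := by
  refine ⟨hg.differentiable.comp (differentiable_id.add_const x), fun ε hε => ?_⟩
  obtain ⟨c, hc⟩ := hg.bound ε hε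
  have hc0 : 0 ≤ c := by
    have := (norm_nonneg _).trans (hc 0)
    simpa using this
  refine ⟨c * Real.exp ((σ + ε) * ‖x‖), fun z => (hc _).trans ?_⟩
  rw [mul_assoc, ← Real.exp_add]
  gcongr
  have := norm_add_le z x
  nlinarith

/-- The polynomially decaying kernel `(1 + |t|) ^ (-r)`. -/
noncomputable def decay (r t : ℝ) : ℝ≥0∞ := ENNReal.ofReal ((1 + |t|) ^ (-r))

theorem measurable_decay (r : ℝ) : Measurable (decay r) := by unfold decay; fun_prop

/-- Discrete majorization at a point of the real line. -/
theorem exists_enorm_rpow_le_tsum {h L δ σ p r : ℝ} (hh : 0 < h) (hL : 0 ≤ L) (hδ : 0 < δ)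
    (hσ : 0 < σ) (hσh : σ < Real.pi / h) (hp : 0 < p) :
    ∃ C : ℝ≥0, ∀ lam : ℤ → ℝ, (∀ k : ℤ, |lam k - h * k| ≤ L) →
      (∀ k l, k ≠ l → δ ≤ |lam k - lam l|) → ∀ g : ℂ → ℂ, IsExpType σ g → ∀ x : ℝ,
        ‖g x‖ₑ ^ p ≤ C * ∑' n, ‖g (lam n)‖ₑ ^ p * decay r (x - lam n) := by
  obtain ⟨C₀, hC₀, H⟩ := exists_norm_zero_le_sampling hh (add_nonneg hL hh.le) hδ hσ hσh ⌈r / p⌉₊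
  refine ⟨(C₀ ^ p).toNNReal, fun lam hn hsep g hg x => ?_⟩
  have hCp : 0 < C₀ ^ p := Real.rpow_pos_of_pos hC₀ p
  set s := ∑' n, ‖g (lam n)‖ₑ ^ p * decay r (x - lam n)
  by_cases hs : s = ∞
  · rw [hs, ENNReal.mul_top]
    · exact le_top
    · simpa using hCp
  set k₀ := round (x / h)
  have hk₀ : |x - h * k₀| ≤ h := by
    have h1 := abs_sub_round (x / h)
    have e : x - h * k₀ = h * (x / h - k₀) := by field_simp
    rw [e, abs_mul, abs_of_pos hh]
    nlinarith
  have hval : ∀ n, ‖g (lam n)‖ ≤ s.toReal ^ p⁻¹ * (1 + |lam n - x|) ^ ⌈r / p⌉₊ := by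
    intro n
    set w := 1 + |lam n - x| with hw
    have hw1 : 1 ≤ w := by rw [hw]; linarith [abs_nonneg (lam n - x)]
    have h1 : ‖g (lam n)‖ₑ ^ p * decay r (x - lam n) ≤ s :=
      ENNReal.le_tsum (f := fun n => ‖g (lam n)‖ₑ ^ p * decay r (x - lam n)) n
    have h2 := ENNReal.toReal_mono hs h1
    rw [ENNReal.toReal_mul, ← ENNReal.toReal_rpow, toReal_enorm, decay, abs_sub_comm,
      ENNReal.toReal_ofReal (by positivity), Real.rpow_neg (by positivity), ← div_eq_mul_inv,
      div_le_iff₀ (by positivity)] at h2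
    calc ‖g (lam n)‖ = (‖g (lam n)‖ ^ p) ^ p⁻¹ := by
          rw [Real.rpow_rpow_inv (norm_nonneg _) hp.ne']
      _ ≤ (s.toReal * w ^ r) ^ p⁻¹ := by gcongr
      _ = s.toReal ^ p⁻¹ * w ^ (r / p) := by
          rw [Real.mul_rpow ENNReal.toReal_nonneg (by positivity), ← Real.rpow_mul (by positivity),
            div_eq_mul_inv]
      _ ≤ s.toReal ^ p⁻¹ * w ^ ⌈r / p⌉₊ := by
          gcongr
          rw [← Real.rpow_natCast]
          exact Real.rpow_le_rpow_of_exponent_le hw1 (Nat.le_ceil _)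
  have hgx := hg.comp_add hσ x
  have h0 := H (fun k => lam (k + k₀) - x) (fun k => ?_) (fun k l hkl => ?_) (fun z => g (z + x))
    hgx.differentiable hgx.bound (s.toReal ^ p⁻¹) (by positivity) (fun n => ?_)
  · have h3 : ‖g x‖ ^ p ≤ C₀ ^ p * s.toReal := by
      rw [zero_add] at h0
      calc ‖g x‖ ^ p ≤ (C₀ * s.toReal ^ p⁻¹) ^ p := by gcongr
        _ = C₀ ^ p * s.toReal := by
          rw [Real.mul_rpow hC₀.le (by positivity),
            Real.rpow_inv_rpow ENNReal.toReal_nonneg hp.ne']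
    calc ‖g x‖ₑ ^ p = ENNReal.ofReal (‖g x‖ ^ p) := by
          rw [← ofReal_norm, ENNReal.ofReal_rpow_of_nonneg (norm_nonneg _) hp.le]
      _ ≤ ENNReal.ofReal (C₀ ^ p * s.toReal) := ENNReal.ofReal_le_ofReal h3
      _ = _ := by
          rw [ENNReal.ofReal_mul hCp.le, ENNReal.ofReal_toReal hs]; rfl
  · have e : lam (k + k₀) - x - h * k = (lam (k + k₀) - h * ((k + k₀ : ℤ) : ℝ)) - (x - h * k₀) := by
      push_cast; ring
    change |lam (k + k₀) - x - h * k| ≤ L + h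
    rw [e]
    exact (abs_sub _ _).trans (add_le_add (hn _) hk₀)
  · have := hsep (k + k₀) (l + k₀) (by simpa using hkl)
    simpa using this
  · have := hval (n + k₀)
    simpa using this

/-- A Logvinenko–Sereda type estimate: integration over a relatively dense set controls the values
of an entire function of exponential type. -/
theorem exists_enorm_rpow_le_setLIntegral {h σ p r c : ℝ} (hh : 0 < h) (hσ : 0 < σ)
    (hσh : σ < Real.pi / h) (hp : 0 < p) (hc : 0 < c) :
    ∃ C : ℝ≥0, ∀ E : Set ℝ, MeasurableSet E →
      (∀ n : ℤ, ENNReal.ofReal c ≤ volume (E ∩ Set.Icc (h * n) (h * n + h / 2))) →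
      ∀ g : ℂ → ℂ, IsExpType σ g → ∀ x : ℝ,
        ‖g x‖ₑ ^ p ≤ C * ∫⁻ t in E, ‖g t‖ₑ ^ p * decay r (x - t) := by
  obtain ⟨C, H⟩ := exists_enorm_rpow_le_tsum hh (half_pos hh).le (half_pos hh) hσ hσh hp
  refine ⟨C * (c.toNNReal)⁻¹, fun E hE hEn g hg x => ?_⟩
  set ψ : ℝ → ℝ≥0∞ := fun t => ‖g t‖ₑ ^ p * decay r (x - t)
  have hψ : Measurable ψ := by
    have h1 : Measurable fun t : ℝ => g t :=
      (hg.differentiable.continuous.comp Complex.continuous_ofReal).measurable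
    exact (h1.enorm.pow_const p).mul ((measurable_decay r).comp (measurable_const.sub measurable_id))
  set I : ℤ → Set ℝ := fun n => E ∩ Set.Icc (h * n) (h * n + h / 2)
  have hI : ∀ n, MeasurableSet (I n) := fun n => hE.inter measurableSet_Icc
  have hc0 : ENNReal.ofReal c ≠ 0 := by simpa using hc
  have hpick : ∀ n, ∃ t ∈ I n, ψ t ≤ (ENNReal.ofReal c)⁻¹ * ∫⁻ s in I n, ψ s := by
    intro n
    have hne : volume (I n) ≠ 0 := fun h0 => hc0 (le_zero_iff.1 ((hEn n).trans h0.le))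
    have hfin : volume (I n) ≠ ∞ :=
      ((measure_mono Set.inter_subset_right).trans_lt (measure_Icc_lt_top)).ne
    obtain ⟨t, ht, hle⟩ := exists_le_setLAverage hne hfin hψ.aemeasurable
    refine ⟨t, ht, hle.trans ?_⟩
    rw [setLAverage_eq, ENNReal.div_eq_inv_mul]
    gcongr
    exact hEn n
  choose t htI htψ using hpick
  have hdisj : Pairwise (Function.onFun Disjoint I) := by
    intro k l hkl
    refine Set.disjoint_left.2 fun s hs hs' => hkl ?_
    have h1 := hs.2; have h2 := hs'.2
    simp only [Set.mem_Icc] at h1 h2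
    have e1 : h * (k : ℝ) < h * (l + 1) := by nlinarith
    have e2 : h * (l : ℝ) < h * (k + 1) := by nlinarith
    have e3 : (k : ℝ) < l + 1 := lt_of_mul_lt_mul_left e1 hh.le
    have e4 : (l : ℝ) < k + 1 := lt_of_mul_lt_mul_left e2 hh.le
    have e5 : k < l + 1 := by exact_mod_cast e3
    have e6 : l < k + 1 := by exact_mod_cast e4
    omega
  have hnear : ∀ k : ℤ, |t k - h * k| ≤ h / 2 := fun k => by
    have h1 := (htI k).2
    simp only [Set.mem_Icc] at h1
    rw [abs_le]; constructor <;> linarith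
  have hsep' : ∀ k l : ℤ, k < l → h / 2 ≤ t l - t k := fun k l hkl => by
    have h1 := (htI k).2
    have h2 := (htI l).2
    simp only [Set.mem_Icc] at h1 h2
    have e : (k : ℝ) + 1 ≤ l := by exact_mod_cast hkl
    nlinarith
  have hsep : ∀ k l : ℤ, k ≠ l → h / 2 ≤ |t k - t l| := fun k l hkl => by
    rcases lt_or_gt_of_ne hkl with hlt | hlt
    · rw [abs_sub_comm]; exact (hsep' k l hlt).trans (le_abs_self _)
    · exact (hsep' l k hlt).trans (le_abs_self _)
  calc ‖g x‖ₑ ^ p ≤ C * ∑' n, ψ (t n) := H t hnear hsep g hg x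
    _ ≤ C * ∑' n, (ENNReal.ofReal c)⁻¹ * ∫⁻ s in I n, ψ s := by
        gcongr with n
        exact htψ n
    _ = C * ((ENNReal.ofReal c)⁻¹ * ∫⁻ s in ⋃ n, I n, ψ s) := by
        rw [ENNReal.tsum_mul_left, lintegral_iUnion hI hdisj]
    _ ≤ C * ((ENNReal.ofReal c)⁻¹ * ∫⁻ s in E, ψ s) := by
        gcongr
        exact Set.iUnion_subset fun n => Set.inter_subset_left
    _ = _ := by
        rw [ENNReal.coe_mul, ENNReal.coe_inv (by simpa using hc), mul_assoc]; rfl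

end OneDimensionalSampling

section IteratedMajorization

open MeasureTheory Function

variable {d : ℕ} {Y : Type*} [MeasurableSpace Y] {μ : Measure Y} [SigmaFinite μ]

theorem lmarginal_mul_prod_succ {F : (Fin d → Y) → ℝ≥0∞} {w : Fin d → (Fin d → Y) → ℝ≥0∞}
    (hF : Measurable F) (hw : ∀ i, Measurable (w i))
    (hdep : ∀ i y y', (∀ j ≤ i, y j = y' j) → w i y = w i y') (i : Fin d) (y : Fin d → Y) :
    (∫⋯∫⁻_Finset.Ici i, (fun z => F z * ∏ j ∈ Finset.Ici i, w j z) ∂fun _ => μ) y =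
      ∫⁻ t, (∫⋯∫⁻_Finset.Ioi i, (fun z => F z * ∏ j ∈ Finset.Ioi i, w j z) ∂fun _ => μ)
        (update y i t) * w i (update y i t) ∂μ := by
  have hins : Finset.Ici i = insert i (Finset.Ioi i) := (Finset.Ioi_insert i).symm
  have hmeas : ∀ s : Finset (Fin d), Measurable fun z => F z * ∏ j ∈ s, w j z := fun s =>
    hF.mul (Finset.measurable_fun_prod s fun j _ => hw j)
  have hni : i ∉ Finset.Ioi i := by simp
  rw [hins, lmarginal_insert _ (hmeas _) hni]
  refine lintegral_congr fun t => ?_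
  have hm : Measurable fun v : Finset.Ioi i → Y => F (updateFinset (update y i t) (Finset.Ioi i) v) *
      ∏ j ∈ Finset.Ioi i, w j (updateFinset (update y i t) (Finset.Ioi i) v) :=
    (hmeas _).comp measurable_updateFinset
  rw [lmarginal, lmarginal, mul_comm, ← lintegral_const_mul _ hm]
  refine lintegral_congr fun v => ?_
  rw [Finset.prod_insert hni]
  have : w i (updateFinset (update y i t) (Finset.Ioi i) v) = w i (update y i t) :=
    hdep i _ _ fun j hj => by simp [updateFinset, not_lt.2 hj]
  rw [this]
  ring

/-- Iteration of one-dimensional majorizations in the successive coordinates. -/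
theorem le_lintegral_prod_of_step {Φ : ℕ → (Fin d → Y) → ℝ≥0∞}
    {w : Fin d → (Fin d → Y) → ℝ≥0∞} {C : Fin d → ℝ≥0} (hΦ : Measurable (Φ d))
    (hw : ∀ i, Measurable (w i)) (hdep : ∀ i y y', (∀ j ≤ i, y j = y' j) → w i y = w i y')
    (step : ∀ (i : Fin d) y, Φ i y ≤ C i * ∫⁻ t, Φ (i + 1) (update y i t) * w i (update y i t) ∂μ)
    (y : Fin d → Y) :
    Φ 0 y ≤ (∏ i, C i : ℝ≥0) * ∫⁻ z, Φ d z * ∏ i, w i z ∂Measure.pi fun _ => μ := by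
  have key : ∀ k ≤ d, ∀ s : Finset (Fin d), (∀ i, i ∈ s ↔ d - k ≤ (i : ℕ)) → ∀ y,
      Φ (d - k) y ≤ (∏ i ∈ s, C i : ℝ≥0) *
        (∫⋯∫⁻_s, (fun z => Φ d z * ∏ j ∈ s, w j z) ∂fun _ => μ) y := by
    intro k
    induction k with
    | zero =>
      intro _ s hs y
      have : s = ∅ := Finset.eq_empty_of_forall_notMem fun i hi => by
        have := (hs i).1 hi
        omega
      subst this
      simp
    | succ k ih =>
      intro hk s hs y
      set i : Fin d := ⟨d - (k + 1), by omega⟩ with hi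
      have hsi : s = Finset.Ici i := by
        ext j
        rw [hs, Finset.mem_Ici, Fin.le_def]
      have hdk : (i : ℕ) + 1 = d - k := by simp only [hi]; omega
      have ih' := ih (by omega) (Finset.Ioi i) fun j => by
        rw [Finset.mem_Ioi, Fin.lt_def, ← hdk]; exact Nat.succ_le_iff.symm
      have hst := step i y
      rw [hdk] at hst
      rw [hsi, lmarginal_mul_prod_succ hΦ hw hdep, ← Finset.mul_prod_erase _ _
        (Finset.mem_Ici.2 le_rfl : i ∈ Finset.Ici i), Finset.Ici_erase]
      refine hst.trans ?_
      rw [ENNReal.coe_mul, mul_assoc]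
      refine mul_le_mul' le_rfl ?_
      rw [← lintegral_const_mul' _ _ ENNReal.coe_ne_top]
      exact lintegral_mono fun t => (mul_le_mul' (ih' _) le_rfl).trans (le_of_eq (mul_assoc _ _ _))
  have := key d le_rfl Finset.univ (by simp) y
  rw [lmarginal_univ] at this
  simpa using this

theorem lintegral_prod_le_of_step {w : Fin d → (Fin d → Y) → ℝ≥0∞} {C : Fin d → ℝ≥0}
    (hw : ∀ i, Measurable (w i)) (hdep : ∀ i y y', (∀ j ≤ i, y j = y' j) → w i y = w i y')
    (step : ∀ (i : Fin d) y, ∫⁻ t, w i (update y i t) ∂μ ≤ C i) [Nonempty Y] :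
    ∫⁻ z, ∏ i, w i z ∂(Measure.pi fun _ => μ) ≤ (∏ i, C i : ℝ≥0) := by
  have key : ∀ k ≤ d, ∀ s : Finset (Fin d), (∀ i, i ∈ s ↔ d - k ≤ (i : ℕ)) → ∀ y,
      (∫⋯∫⁻_s, (fun z => 1 * ∏ j ∈ s, w j z) ∂fun _ => μ) y ≤ (∏ i ∈ s, C i : ℝ≥0) := by
    intro k
    induction k with
    | zero =>
      intro _ s hs y
      have : s = ∅ := Finset.eq_empty_of_forall_notMem fun i hi => by
        have := (hs i).1 hi
        omega
      subst this
      simp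
    | succ k ih =>
      intro hk s hs y
      set i : Fin d := ⟨d - (k + 1), by omega⟩ with hi
      have hsi : s = Finset.Ici i := by
        ext j
        rw [hs, Finset.mem_Ici, Fin.le_def]
      have hdk : (i : ℕ) + 1 = d - k := by simp only [hi]; omega
      have ih' := ih (by omega) (Finset.Ioi i) fun j => by
        rw [Finset.mem_Ioi, Fin.lt_def, ← hdk]; exact Nat.succ_le_iff.symm
      rw [hsi, lmarginal_mul_prod_succ measurable_const hw hdep, ← Finset.mul_prod_erase _ _
        (Finset.mem_Ici.2 le_rfl : i ∈ Finset.Ici i), Finset.Ici_erase]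
      calc _ ≤ ∫⁻ t, (∏ j ∈ Finset.Ioi i, C j : ℝ≥0) * w i (update y i t) ∂μ := by
            gcongr with t
            exact ih' _
        _ = (∏ j ∈ Finset.Ioi i, C j : ℝ≥0) * ∫⁻ t, w i (update y i t) ∂μ :=
            lintegral_const_mul' _ _ ENNReal.coe_ne_top
        _ ≤ (∏ j ∈ Finset.Ioi i, C j : ℝ≥0) * C i := by gcongr; exact step i y
        _ = _ := by rw [ENNReal.coe_mul, mul_comm]
  have := key d le_rfl Finset.univ (by simp) (fun _ => Classical.arbitrary Y)
  rw [lmarginal_univ] at this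
  simpa using this

theorem lintegral_pi_count (F : (Fin d → ℤ) → ℝ≥0∞) :
    ∫⁻ n, F n ∂(Measure.pi fun _ : Fin d => (Measure.count : Measure ℤ)) = ∑' n, F n := by
  rw [lintegral_countable']
  refine tsum_congr fun n => ?_
  rw [Measure.pi_singleton]
  simp

/-- Continuous functions whose restriction to every line parallel to the `i`-th axis extends to an
entire function of exponential type at most `σ i`. -/
structure IsSliceExpType (σ : Fin d → ℝ) (f : (Fin d → ℝ) → ℂ) : Prop where
  continuous : Continuous f
  slice : ∀ (i : Fin d) (x : Fin d → ℝ), ∃ g : ℂ → ℂ, IsExpType (σ i) g ∧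
    ∀ t : ℝ, g t = f (update x i t)

theorem update_ite_lt {X : Type*} (x y : Fin d → X) (i : Fin d) (t : X) (y' : Fin d → X)
    (h1 : ∀ j < i, y' j = y j) (h2 : y' i = t) :
    update (fun l : Fin d => if (l : ℕ) < i then y l else x l) i t =
      fun l : Fin d => if (l : ℕ) < (i : ℕ) + 1 then y' l else x l := by
  funext l
  rcases lt_trichotomy l i with hl | rfl | hl
  · have hl' : (l : ℕ) < i := hl
    rw [update_of_ne hl.ne, if_pos hl', if_pos (by omega), h1 l hl]
  · rw [update_self, if_pos (by omega), h2]
  · have hl' : (i : ℕ) < l := hl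
    rw [update_of_ne hl.ne', if_neg (by omega), if_neg (by omega)]

/-- The conditions on the sampling sequence, for sequences of points of `Fin d → ℝ`. -/
structure IsSamplingSeq (h : Fin d → ℝ) (δ L : ℝ) (lam : (Fin d → ℤ) → Fin d → ℝ) : Prop where
  depends : ∀ (i : Fin d) (n n' : Fin d → ℤ), (∀ j ≤ i, n j = n' j) → lam n i = lam n' i
  near : ∀ n i, |lam n i - h i * n i| ≤ L
  sep : ∀ n i (k l : ℤ), k ≠ l → δ ≤ |lam (update n i k) i - lam (update n i l) i|

theorem exists_enorm_rpow_le_tsum_pi {h σ : Fin d → ℝ} {δ L p r : ℝ} (hh : ∀ i, 0 < h i)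
    (hL : 0 ≤ L) (hδ : 0 < δ) (hσ : ∀ i, 0 < σ i) (hσh : ∀ i, σ i < Real.pi / h i) (hp : 0 < p) :
    ∃ C : ℝ≥0, ∀ lam, IsSamplingSeq h δ L lam → ∀ f, IsSliceExpType σ f → ∀ x,
      ‖f x‖ₑ ^ p ≤ C * ∑' n, ‖f (lam n)‖ₑ ^ p * ∏ i, decay r (x i - lam n i) := by
  choose C H using fun i =>
    exists_enorm_rpow_le_tsum (hh i) hL hδ (hσ i) (hσh i) hp
  refine ⟨∏ i, C i, fun lam hlam f hf x => ?_⟩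
  have key := le_lintegral_prod_of_step (μ := (Measure.count : Measure ℤ)) (C := C)
    (Φ := fun k n => ‖f fun l : Fin d => if (l : ℕ) < k then lam n l else x l‖ₑ ^ p)
    (w := fun i n => decay r (x i - lam n i)) (Measurable.of_discrete)
    (fun i => Measurable.of_discrete) (fun i n n' hnn => by rw [hlam.depends i n n' hnn])
    (fun i n => ?_) 0
  · rw [lintegral_pi_count] at key
    simpa using key
  · obtain ⟨g, hg, hgf⟩ := hf.slice i (fun l : Fin d => if (l : ℕ) < i then lam n l else x l)
    have h1 := H i (fun k => lam (update n i k) i)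
      (fun k => by simpa using hlam.near (update n i k) i)
      (fun k l hkl => hlam.sep n i k l hkl) g hg (x i)
    rw [lintegral_count]
    have e0 : g (x i) = f fun l : Fin d => if (l : ℕ) < i then lam n l else x l := by
      rw [hgf]
      congr 1
      refine update_eq_self_iff.2 ?_
      simp
    rw [e0] at h1
    refine h1.trans (le_of_eq ?_)
    congr 1
    refine tsum_congr fun k => ?_
    rw [hgf, update_ite_lt x (lam n) i _ (lam (update n i k)) (fun j hj => ?_) rfl]
    refine hlam.depends j _ _ fun l hl => ?_
    rw [update_of_ne (hl.trans_lt hj).ne]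

theorem exists_enorm_rpow_le_setLIntegral_pi {ι : Type*} [Fintype ι] {h σ : Fin d → ℝ} {p r : ℝ}
    (hh : ∀ i, 0 < h i) (hσ : ∀ i, 0 < σ i) (hσh : ∀ i, σ i < Real.pi / h i) (hp : 0 < p) (β : ι → Fin d → ℝ) (hβ : ∀ j, β j ≠ 0) :
    ∃ δ : ℝ, 0 < δ ∧ ∃ C : ℝ≥0, ∀ f, IsSliceExpType σ f → ∀ x,
      ‖f x‖ₑ ^ p ≤ C * ∫⁻ z in {z : Fin d → ℝ | ∀ j, δ ≤ |∑ l, β j l * z l|},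
        ‖f z‖ₑ ^ p * ∏ i, decay r (x i - z i) := by
  classical
  choose C H using fun i => exists_enorm_rpow_le_setLIntegral (hh i) (hσ i) (hσh i) hp
    (show 0 < h i / 4 by have := hh i; positivity)
  obtain ⟨δ, hδ0, hδ⟩ : ∃ δ : ℝ, 0 < δ ∧ ∀ i, ∑ j, 2 * δ / |β j i| ≤ h i / 4 := by
    have h1 : ∀ i, ∀ᶠ δ : ℝ in nhdsWithin 0 (Set.Ioi 0), ∑ j, 2 * δ / |β j i| < h i / 4 := by
      intro i
      have hc : Filter.Tendsto (fun δ : ℝ => ∑ j, 2 * δ / |β j i|) (nhdsWithin 0 (Set.Ioi 0))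
          (nhds 0) := by
        refine Filter.Tendsto.mono_left ?_ nhdsWithin_le_nhds
        exact Continuous.tendsto' (by fun_prop) _ _ (by simp)
      exact hc.eventually (gt_mem_nhds (by have := hh i; positivity))
    obtain ⟨δ, h2, h3⟩ := ((Filter.eventually_all.2 h1).and self_mem_nhdsWithin).exists
    exact ⟨δ, h3, fun i => (h2 i).le⟩
  set J : Fin d → ι → Prop := fun i j => β j i ≠ 0 ∧ ∀ l, i < l → β j l = 0
  set χ : Fin d → Set (Fin d → ℝ) := fun i => {z | ∀ j, J i j → δ ≤ |∑ l, β j l * z l|}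
  have hχm : ∀ i, MeasurableSet (χ i) := fun i => by
    have e : χ i = ⋂ j, ⋂ _ : J i j, {z | δ ≤ |∑ l, β j l * z l|} := by
      ext z; simp [χ]
    rw [e]
    refine MeasurableSet.iInter fun j => MeasurableSet.iInter fun _ => ?_
    exact measurableSet_le measurable_const (by fun_prop)
  have hχdep : ∀ i y y', (∀ j ≤ i, y j = y' j) → (y ∈ χ i ↔ y' ∈ χ i) := by
    intro i y y' hy
    have : ∀ j, J i j → ∑ l, β j l * y l = ∑ l, β j l * y' l := fun j hj => by
      refine Finset.sum_congr rfl fun l _ => ?_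
      rcases le_or_gt l i with hl | hl
      · rw [hy l hl]
      · rw [hj.2 l hl, zero_mul, zero_mul]
    constructor
    · intro hz j hj
      rw [← this j hj]; exact hz j hj
    · intro hz j hj
      rw [this j hj]; exact hz j hj
  refine ⟨δ, hδ0, ∏ i, C i, fun f hf x => ?_⟩
  have hdecm : ∀ i, Measurable fun y : Fin d → ℝ => decay r (x i - y i) := fun i =>
    (measurable_decay r).comp (by fun_prop)
  have key := le_lintegral_prod_of_step (μ := (volume : Measure ℝ)) (C := C)
    (Φ := fun k y => ‖f fun l : Fin d => if (l : ℕ) < k then y l else x l‖ₑ ^ p)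
    (w := fun i y => (χ i).indicator (fun y => decay r (x i - y i)) y) ?_
    (fun i => (hdecm i).indicator (hχm i)) (fun i y y' hyy => ?_) (fun i y => ?_) 0
  · simp only [Fin.is_lt, if_true, not_lt_zero, if_false, ← volume_pi] at key
    refine key.trans (mul_le_mul' le_rfl ?_)
    rw [← lintegral_indicator]
    · refine lintegral_mono fun z => ?_
      by_cases hz : ∀ j, δ ≤ |∑ l, β j l * z l|
      · rw [Set.indicator_of_mem (show z ∈ {z : Fin d → ℝ | ∀ j, δ ≤ |∑ l, β j l * z l|} from hz)]
        gcongr with i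
        exact Set.indicator_le_self _ _ _
      · push Not at hz
        obtain ⟨j, hj⟩ := hz
        have hex : ∃ i, J i j := by
          have hne : (Finset.univ.filter fun i => β j i ≠ 0).Nonempty := by
            by_contra hcon
            rw [Finset.not_nonempty_iff_eq_empty, Finset.filter_eq_empty_iff] at hcon
            exact hβ j (funext fun i => by simpa using hcon (Finset.mem_univ i))
          obtain ⟨i, hi, hmax⟩ := Finset.exists_max_image _ id hne
          refine ⟨i, (Finset.mem_filter.1 hi).2, fun l hl => ?_⟩
          by_contra hcon
          exact absurd (hmax l (Finset.mem_filter.2 ⟨Finset.mem_univ l, hcon⟩)) (not_le.2 hl)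
        obtain ⟨i, hi⟩ := hex
        have hnot : z ∉ χ i := fun hc => absurd (hc j hi) (not_le.2 hj)
        have hzero : (χ i).indicator (fun y => decay r (x i - y i)) z = 0 :=
          Set.indicator_of_notMem hnot _
        rw [Finset.prod_eq_zero (Finset.mem_univ i) hzero, mul_zero]
        exact zero_le
    · have e : {z : Fin d → ℝ | ∀ j, δ ≤ |∑ l, β j l * z l|} =
          ⋂ j, {z | δ ≤ |∑ l, β j l * z l|} := by ext z; simp
      rw [e]
      exact MeasurableSet.iInter fun j => measurableSet_le measurable_const (by fun_prop)
  · simp only [Fin.is_lt, if_true]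
    exact hf.continuous.measurable.enorm.pow_const p
  · simp only [Set.indicator, hχdep i y y' hyy, hyy i le_rfl]
  · obtain ⟨g, hg, hgf⟩ := hf.slice i (fun l : Fin d => if (l : ℕ) < i then y l else x l)
    set E : Set ℝ := {t | update y i t ∈ χ i}
    have hEm : MeasurableSet E := (measurable_update y) (hχm i)
    have h1 := H i E hEm (fun n => ?_) g hg (x i)
    · have e0 : g (x i) = f fun l : Fin d => if (l : ℕ) < i then y l else x l := by
        rw [hgf]
        congr 1
        refine update_eq_self_iff.2 ?_
        simp
      rw [e0] at h1
      refine h1.trans (le_of_eq ?_)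
      congr 1
      rw [← lintegral_indicator hEm]
      refine lintegral_congr fun t => ?_
      by_cases ht : t ∈ E
      · have ht' : update y i t ∈ χ i := ht
        rw [Set.indicator_of_mem ht, Set.indicator_of_mem ht', hgf, update_self,
          update_ite_lt x y i t (update y i t) (fun j hj => update_of_ne hj.ne _ _)
            (update_self _ _ _)]
      · have ht' : update y i t ∉ χ i := ht
        rw [Set.indicator_of_notMem ht, Set.indicator_of_notMem ht', mul_zero]
    · set I := Set.Icc (h i * n) (h i * n + h i / 2)
      have hcover : I ⊆ (E ∩ I) ∪ ⋃ j, {t : ℝ | J i j ∧ |∑ l, β j l * update y i t l| < δ} := by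
        intro t ht
        by_cases htE : t ∈ E
        · exact Or.inl ⟨htE, ht⟩
        · right
          have : ¬ ∀ j, J i j → δ ≤ |∑ l, β j l * update y i t l| := htE
          push Not at this
          obtain ⟨j, hj, hjt⟩ := this
          exact Set.mem_iUnion.2 ⟨j, hj, hjt⟩
      have hbad : ∀ j, volume {t : ℝ | J i j ∧ |∑ l, β j l * update y i t l| < δ} ≤
          ENNReal.ofReal (2 * δ / |β j i|) := by
        intro j
        by_cases hj : J i j
        · have hb : 0 < |β j i| := abs_pos.2 hj.1
          set s := ∑ l ∈ Finset.univ.erase i, β j l * y l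
          have hsub : {t : ℝ | J i j ∧ |∑ l, β j l * update y i t l| < δ} ⊆
              Metric.ball (-s / β j i) (δ / |β j i|) := by
            rintro t ⟨-, ht⟩
            rw [← Finset.add_sum_erase _ _ (Finset.mem_univ i), update_self] at ht
            have e : ∑ l ∈ Finset.univ.erase i, β j l * update y i t l = s :=
              Finset.sum_congr rfl fun l hl => by rw [update_of_ne (Finset.ne_of_mem_erase hl)]
            rw [e] at ht
            have e2 : t - -s / β j i = (β j i * t + s) / β j i := by
              have := hj.1
              field_simp
              ring
            rw [Metric.mem_ball, Real.dist_eq, e2, abs_div]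
            exact div_lt_div_of_pos_right ht hb
          refine (measure_mono hsub).trans ?_
          rw [Real.volume_ball, mul_div_assoc]
        · have : {t : ℝ | J i j ∧ |∑ l, β j l * update y i t l| < δ} = ∅ := by
            ext t; simp [hj]
          rw [this, measure_empty]
          exact zero_le
      have hmeas : ENNReal.ofReal (h i / 2) ≤
          volume (E ∩ I) + ENNReal.ofReal (h i / 4) := by
        calc ENNReal.ofReal (h i / 2) = volume I := by
              rw [Real.volume_Icc]; congr 1; ring
          _ ≤ volume (E ∩ I) + volume (⋃ j, {t : ℝ | J i j ∧ |∑ l, β j l * update y i t l| < δ}) :=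
              (measure_mono hcover).trans (measure_union_le _ _)
          _ ≤ volume (E ∩ I) + ∑ j, ENNReal.ofReal (2 * δ / |β j i|) := by
              gcongr
              refine (measure_iUnion_fintype_le _ _).trans ?_
              exact Finset.sum_le_sum fun j _ => hbad j
          _ ≤ _ := by
              gcongr
              rw [← ENNReal.ofReal_sum_of_nonneg fun j _ => by positivity]
              exact ENNReal.ofReal_le_ofReal (hδ i)
      have hsplit : ENNReal.ofReal (h i / 2) =
          ENNReal.ofReal (h i / 4) + ENNReal.ofReal (h i / 4) := by
        have := hh i
        rw [← ENNReal.ofReal_add (by positivity) (by positivity)]; congr 1; ring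
      rw [hsplit] at hmeas
      exact (ENNReal.add_le_add_iff_right ENNReal.ofReal_ne_top).1 hmeas

end IteratedMajorization

section PowerWeight

open MeasureTheory Function

theorem lintegral_decay_two_lt_top (c : ℝ) : ∫⁻ t, decay 2 (t - c) < ∞ := by
  rw [lintegral_sub_right_eq_self (decay 2) c]
  have := finite_integral_one_add_norm (E := ℝ) (μ := volume) (r := 2) (by simp)
  simpa [decay] using this

theorem exists_tsum_decay_two_le {h L : ℝ} (hh : 0 < h) (hL : 0 ≤ L) :
    ∃ S : ℝ≥0, ∀ lam : ℤ → ℝ, (∀ k : ℤ, |lam k - h * k| ≤ L) → ∀ x : ℝ,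
      ∑' k, decay 2 (lam k - x) ≤ S := by
  obtain ⟨S, hS0, HS⟩ := exists_sum_lattice_inv_sq_le hh
  refine ⟨((1 + L) ^ 2 * S).toNNReal, fun lam hn x => ?_⟩
  rw [ENNReal.tsum_eq_iSup_sum]
  refine iSup_le fun F => ?_
  unfold decay
  rw [← ENNReal.ofReal_sum_of_nonneg fun k _ => by positivity]
  refine ENNReal.ofReal_le_ofReal ?_
  calc ∑ k ∈ F, (1 + |lam k - x|) ^ (-2 : ℝ)
      ≤ ∑ k ∈ F, (1 + L) ^ 2 * ((1 + |h * k - x|) ^ 2)⁻¹ := by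
        refine Finset.sum_le_sum fun k _ => ?_
        rw [Real.rpow_neg (by positivity), Real.rpow_two, ← div_eq_mul_inv,
          le_div_iff₀ (by positivity), inv_mul_le_iff₀ (by positivity), ← mul_pow]
        refine pow_le_pow_left₀ (by positivity) ?_ 2
        have h1 : |h * k - x| ≤ |lam k - h * k| + |lam k - x| := by
          have : h * k - x = -(lam k - h * k) + (lam k - x) := by ring
          rw [this]
          exact (abs_add_le _ _).trans (by rw [abs_neg])
        have := hn k
        have := abs_nonneg (lam k - x)
        nlinarith
    _ = (1 + L) ^ 2 * ∑ k ∈ F, ((1 + |h * k - x|) ^ 2)⁻¹ := by rw [Finset.mul_sum]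
    _ ≤ _ := by gcongr; exact HS x F

variable {d m : ℕ}

theorem EuclideanSpace.one_add_norm_sub_le_prod (x y : EuclideanSpace ℝ (Fin d)) :
    1 + ‖x - y‖ ≤ ∏ i, (1 + |x i - y i|) := by
  have h1 : ‖x - y‖ ≤ ∑ i, |x i - y i| := by
    have h2 : x - y = ∑ i, EuclideanSpace.single i ((x - y) i) := by
      ext j; simp [Finset.sum_apply, Pi.single_apply]
    rw [h2]
    refine (norm_sum_le _ _).trans (le_of_eq ?_)
    refine Finset.sum_congr rfl fun i _ => ?_
    simp
  have h3 : ∀ s : Finset (Fin d), 1 + ∑ i ∈ s, |x i - y i| ≤ ∏ i ∈ s, (1 + |x i - y i|) := by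
    intro s
    induction s using Finset.induction_on with
    | empty => simp
    | insert i s hi ih =>
      rw [Finset.sum_insert hi, Finset.prod_insert hi]
      have h4 : 0 ≤ ∑ i ∈ s, |x i - y i| := Finset.sum_nonneg fun _ _ => abs_nonneg _
      nlinarith [abs_nonneg (x i - y i)]
  linarith [h3 Finset.univ]

theorem powerWeight_nonneg (α : Fin m → EuclideanSpace ℝ (Fin d)) (k₀ : ℝ) (k : Fin m → ℝ)
    (x : EuclideanSpace ℝ (Fin d)) : 0 ≤ powerWeight α k₀ k x := by
  unfold powerWeight; positivity

theorem measurable_powerWeight (α : Fin m → EuclideanSpace ℝ (Fin d)) (k₀ : ℝ) (k : Fin m → ℝ) :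
    Measurable (powerWeight α k₀ k) := by
  unfold powerWeight; fun_prop

/-- Comparison of the values of the power weight at two points, the second one staying away from
the zeros. -/
theorem exists_powerWeight_le (α : Fin m → EuclideanSpace ℝ (Fin d)) {k₀ : ℝ} (hk₀ : 0 ≤ k₀)
    {k : Fin m → ℝ} (hk : ∀ j, 0 < k j) {δ : ℝ} (hδ : 0 < δ) :
    ∃ C : ℝ, 0 ≤ C ∧ ∀ x y : EuclideanSpace ℝ (Fin d), δ ≤ ‖y‖ →
      (∀ j, δ ≤ |inner ℝ (α j) y|) →
      powerWeight α k₀ k x ≤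
        C * powerWeight α k₀ k y * (∏ i, (1 + |x i - y i|)) ^ (k₀ + ∑ j, k j) := by
  refine ⟨(1 + 1 / δ) ^ k₀ * ∏ j, (1 + ‖α j‖ / δ) ^ k j, by positivity, fun x y hy hαy => ?_⟩
  set P := ∏ i, (1 + |x i - y i|)
  have hP := EuclideanSpace.one_add_norm_sub_le_prod x y
  have hP0 : 0 < P := Finset.prod_pos fun i _ => by positivity
  have hxy := norm_nonneg (x - y)
  have hxn : ‖x‖ ≤ (1 + 1 / δ) * ‖y‖ * P := by
    have h1 : ‖x‖ ≤ ‖y‖ + ‖x - y‖ := by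
      have := norm_add_le y (x - y)
      rwa [add_sub_cancel] at this
    have h2 : 1 ≤ 1 / δ * ‖y‖ := by
      rw [one_div, inv_mul_eq_div, one_le_div hδ]; exact hy
    have h3 : ‖y‖ ≤ ‖y‖ * P := le_mul_of_one_le_right (norm_nonneg y) (by linarith)
    nlinarith
  have hxα : ∀ j, |inner ℝ (α j) x| ≤ (1 + ‖α j‖ / δ) * |inner ℝ (α j) y| * P := by
    intro j
    have h1 : |inner ℝ (α j) x| ≤ |inner ℝ (α j) y| + ‖α j‖ * ‖x - y‖ := by
      have e : (inner ℝ (α j) x : ℝ) = inner ℝ (α j) y + inner ℝ (α j) (x - y) := by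
        rw [← inner_add_right, add_sub_cancel]
      rw [e]
      exact (abs_add_le _ _).trans (add_le_add le_rfl (abs_real_inner_le_norm _ _))
    have h2 : ‖α j‖ ≤ ‖α j‖ / δ * |inner ℝ (α j) y| := by
      rw [div_mul_eq_mul_div, le_div_iff₀ hδ]
      exact mul_le_mul_of_nonneg_left (hαy j) (norm_nonneg _)
    have h3 : |inner ℝ (α j) y| ≤ |inner ℝ (α j) y| * P :=
      le_mul_of_one_le_right (abs_nonneg _) (by linarith)
    have h4 : ‖α j‖ * ‖x - y‖ ≤ ‖α j‖ / δ * |inner ℝ (α j) y| * P := by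
      refine mul_le_mul h2 (by linarith) hxy (by positivity)
    linarith
  calc powerWeight α k₀ k x
      ≤ ((1 + 1 / δ) * ‖y‖ * P) ^ k₀ * ∏ j, ((1 + ‖α j‖ / δ) * |inner ℝ (α j) y| * P) ^ k j := by
        unfold powerWeight
        gcongr with j
        · exact (hk j).le
        · exact hxα j
    _ = ((1 + 1 / δ) ^ k₀ * ∏ j, (1 + ‖α j‖ / δ) ^ k j) * powerWeight α k₀ k y *
          (P ^ k₀ * ∏ j, P ^ k j) := by
        unfold powerWeight
        rw [Real.mul_rpow (by positivity) hP0.le, Real.mul_rpow (by positivity) (norm_nonneg y)]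
        have : ∀ j, ((1 + ‖α j‖ / δ) * |inner ℝ (α j) y| * P) ^ k j =
            (1 + ‖α j‖ / δ) ^ k j * |inner ℝ (α j) y| ^ k j * P ^ k j := fun j => by
          rw [Real.mul_rpow (by positivity) hP0.le, Real.mul_rpow (by positivity) (abs_nonneg _)]
        simp only [this, Finset.prod_mul_distrib]
        ring
    _ = _ := by
        rw [Real.rpow_add hP0, Real.rpow_sum_of_pos hP0]

theorem exists_powerWeight_mul_decay_le (α : Fin m → EuclideanSpace ℝ (Fin d)) {k₀ : ℝ}
    (hk₀ : 0 ≤ k₀) {k : Fin m → ℝ} (hk : ∀ j, 0 < k j) {δ : ℝ} (hδ : 0 < δ) :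
    ∃ C : ℝ≥0, ∀ x y : EuclideanSpace ℝ (Fin d), δ ≤ ‖y‖ → (∀ j, δ ≤ |inner ℝ (α j) y|) →
      ENNReal.ofReal (powerWeight α k₀ k x) * ∏ i, decay (k₀ + ∑ j, k j + 2) (x i - y i) ≤
        C * (ENNReal.ofReal (powerWeight α k₀ k y) * ∏ i, decay 2 (x i - y i)) := by
  obtain ⟨C, hC, H⟩ := exists_powerWeight_le α hk₀ hk hδ
  refine ⟨C.toNNReal, fun x y hy hαy => ?_⟩
  set M := k₀ + ∑ j, k j
  have hprod : ∀ r, ∏ i, decay r (x i - y i) = ENNReal.ofReal ((∏ i, (1 + |x i - y i|)) ^ (-r)) := by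
    intro r
    unfold decay
    rw [← ENNReal.ofReal_prod_of_nonneg fun i _ => by positivity,
      Real.finsetProd_rpow _ _ fun i _ => by positivity]
  set P := ∏ i, (1 + |x i - y i|)
  have hP0 : 0 < P := Finset.prod_pos fun i _ => by positivity
  have hvy := powerWeight_nonneg α k₀ k y
  rw [hprod, hprod, ← ENNReal.ofReal_mul (powerWeight_nonneg α k₀ k x), ← ENNReal.ofReal_mul hvy]
  change _ ≤ ENNReal.ofReal C * _
  rw [← ENNReal.ofReal_mul hC]
  refine ENNReal.ofReal_le_ofReal ?_
  calc powerWeight α k₀ k x * P ^ (-(M + 2))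
      ≤ C * powerWeight α k₀ k y * P ^ M * P ^ (-(M + 2)) := by
        gcongr
        exact H x y hy hαy
    _ = C * (powerWeight α k₀ k y * P ^ (-2 : ℝ)) := by
        have : P ^ (-2 : ℝ) = P ^ M * P ^ (-(M + 2)) := by
          rw [← Real.rpow_add hP0]; congr 1; ring
        rw [this]; ring

theorem MemExpType.isSliceExpType {σ : Fin d → ℝ} {f : EuclideanSpace ℝ (Fin d) → ℂ}
    (hf : MemExpType σ f) : IsSliceExpType σ fun z => f (WithLp.toLp 2 z) := by
  obtain ⟨F, hF, hFf, hexp⟩ := hf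
  have hval : ∀ z : Fin d → ℝ, f (WithLp.toLp 2 z) = F fun i => (z i : ℂ) := fun z =>
    (hFf (WithLp.toLp 2 z)).symm
  refine ⟨?_, fun i x => ⟨fun t => F (update (fun l => (x l : ℂ)) i t), ⟨?_, fun ε hε => ?_⟩,
    fun t => ?_⟩⟩
  · simp only [hval]
    exact hF.continuous.comp (by fun_prop)
  · refine hF.comp (differentiable_pi.2 fun l => ?_)
    by_cases hl : l = i
    · subst hl; simp
    · simp [update_of_ne hl]
  · obtain ⟨c, hc⟩ := hexp ε hε
    refine ⟨c * Real.exp (∑ l ∈ Finset.univ.erase i, (σ l + ε) * |x l|), fun t => (hc _).trans ?_⟩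
    rw [← Finset.add_sum_erase _ _ (Finset.mem_univ i), update_self, Real.exp_add,
      mul_assoc, mul_comm (Real.exp (∑ l ∈ _, _ * |x l|))]
    refine le_of_eq ?_
    congr 3
    refine Finset.sum_congr rfl fun l hl => ?_
    rw [update_of_ne (Finset.ne_of_mem_erase hl), Complex.norm_real, Real.norm_eq_abs]
  · change F (update (fun l => (x l : ℂ)) i t) = f (WithLp.toLp 2 (update x i t))
    rw [hval]
    congr 1
    funext l
    by_cases hl : l = i
    · subst hl; simp
    · simp [update_of_ne hl]

theorem IsTriangularSeq.isSamplingSeq {δ L : ℝ} {a : Fin d → ℝ}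
    {lam : (Fin d → ℤ) → EuclideanSpace ℝ (Fin d)} (h1 : IsTriangularSeq lam)
    (h2 : IsSepSeq δ lam) (h3 : IsNearLatticeSeq a L lam) :
    IsSamplingSeq (fun i => Real.pi / a i) δ L fun n => (lam n).ofLp := by
  have hlt : ∀ n i (k l : ℤ), k < l → δ ≤ lam (update n i l) i - lam (update n i k) i := by
    intro n i k l hkl
    have e1 := h2 (update n i k) i
    simp only [update_self, update_idem] at e1
    have e2 : lam (update n i (k + 1)) i ≤ lam (update n i l) i := by
      rcases (Int.add_one_le_iff.2 hkl).eq_or_lt with rfl | hlt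
      · exact le_rfl
      · exact (h1.increasing i _ _ (fun j hj => by simp [update_of_ne hj.ne]) (by simpa using hlt)).le
    linarith
  refine ⟨h1.depends, fun n i => ?_, fun n i k l hkl => ?_⟩
  · have := h3 n i
    rwa [div_mul_eq_mul_div]
  · rcases lt_or_gt_of_ne hkl with hkl | hkl
    · rw [abs_sub_comm]; exact (hlt n i k l hkl).trans (le_abs_self _)
    · exact (hlt n i l k hkl).trans (le_abs_self _)

theorem EuclideanSpace.lintegral_eq_lintegral_pi (F : EuclideanSpace ℝ (Fin d) → ℝ≥0∞) :
    ∫⁻ x, F x = ∫⁻ z : Fin d → ℝ, F (WithLp.toLp 2 z) :=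
  ((EuclideanSpace.volume_preserving_symm_measurableEquiv_toLp (Fin d)).symm.lintegral_comp_emb
    (MeasurableEquiv.toLp 2 (Fin d → ℝ)).measurableEmbedding F).symm

end PowerWeight

theorem theorem5p13 {d m : ℕ} (hd : 0 < d)
    (α : Fin m → EuclideanSpace ℝ (Fin d)) (hα : ∀ j, α j ≠ 0)
    (k₀ : ℝ) (hk₀ : 0 ≤ k₀) (k : Fin m → ℝ) (hk : ∀ j, 0 < k j)
    (σ a : Fin d → ℝ) (hσ : ∀ i, 0 < σ i) (ha : ∀ i, σ i < a i)
    (δ L : ℝ) (hδ : 0 < δ) (hL : 0 < L) (p : ℝ) (hp : 0 < p) :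
    ∃ C₁ C₂ : ℝ≥0, 0 < C₁ ∧ 0 < C₂ ∧
      ∀ lam : (Fin d → ℤ) → EuclideanSpace ℝ (Fin d),
        IsTriangularSeq lam → IsSepSeq δ lam → IsNearLatticeSeq a L lam → AvoidsZeros α δ lam →
        ∀ f : EuclideanSpace ℝ (Fin d) → ℂ, MemExpType σ f →
          (∑' n : Fin d → ℤ, ENNReal.ofReal (powerWeight α k₀ k (lam n) * ‖f (lam n)‖ ^ p)
              ≤ (C₁ : ℝ≥0∞) *
                ∫⁻ x : EuclideanSpace ℝ (Fin d), ENNReal.ofReal (‖f x‖ ^ p * powerWeight α k₀ k x)) ∧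
          (∫⁻ x : EuclideanSpace ℝ (Fin d), ENNReal.ofReal (‖f x‖ ^ p * powerWeight α k₀ k x)
              ≤ (C₂ : ℝ≥0∞) *
                ∑' n : Fin d → ℤ,
                  ENNReal.ofReal (powerWeight α k₀ k (lam n) * ‖f (lam n)‖ ^ p)) := by
  have ha0 : ∀ i, 0 < a i := fun i => (hσ i).trans (ha i)
  have hh : ∀ i, 0 < Real.pi / a i := fun i => div_pos Real.pi_pos (ha0 i)
  have hσh : ∀ i, σ i < Real.pi / (Real.pi / a i) := fun i => by
    rw [div_div_cancel₀ Real.pi_ne_zero]; exact ha i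
  set r := k₀ + ∑ j, k j + 2
  set β : Option (Fin m) → Fin d → ℝ := fun o => o.elim (Pi.single ⟨0, hd⟩ 1) fun j => (α j).ofLp
  have hβ : ∀ o, β o ≠ 0 := by
    rintro (_ | j)
    · intro hc
      have := congrFun hc ⟨0, hd⟩
      simp [β] at this
    · intro hc
      refine hα j ?_
      ext i
      exact congrFun hc i
  obtain ⟨δ', hδ', D₁, H₁⟩ := exists_enorm_rpow_le_setLIntegral_pi hh hσ hσh hp β hβ
  obtain ⟨D₂, H₂⟩ := exists_enorm_rpow_le_tsum_pi hh hL.le hδ hσ hσh hp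
  obtain ⟨W₁, HW₁⟩ := exists_powerWeight_mul_decay_le α hk₀ hk hδ'
  obtain ⟨W₂, HW₂⟩ := exists_powerWeight_mul_decay_le α hk₀ hk hδ
  choose S HS using fun i => exists_tsum_decay_two_le (hh i) hL.le
  set I : ℝ≥0 := (∫⁻ t : ℝ, decay 2 (t - 0)).toNNReal
  have hI : ∀ c : ℝ, ∫⁻ t : ℝ, decay 2 (t - c) ≤ I := fun c => by
    rw [ENNReal.coe_toNNReal (lintegral_decay_two_lt_top 0).ne,
      MeasureTheory.lintegral_sub_right_eq_self (decay 2) c,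
      MeasureTheory.lintegral_sub_right_eq_self (decay 2) 0]
  refine ⟨D₁ * W₁ * (∏ i, S i) + 1, D₂ * W₂ * (∏ _i : Fin d, I) + 1, by positivity, by positivity,
    fun lam hlam1 hlam2 hlam3 hlam4 f hf => ?_⟩
  have hs := hlam1.isSamplingSeq hlam2 hlam3
  have hfs := hf.isSliceExpType
  set v : EuclideanSpace ℝ (Fin d) → ℝ≥0∞ := fun x => ENNReal.ofReal (powerWeight α k₀ k x)
  have hv : ∀ x, ENNReal.ofReal (powerWeight α k₀ k x * ‖f x‖ ^ p) = v x * ‖f x‖ₑ ^ p := fun x => by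
    rw [ENNReal.ofReal_mul (powerWeight_nonneg α k₀ k x),
      ← ENNReal.ofReal_rpow_of_nonneg (norm_nonneg _) hp.le, ofReal_norm]
  have hv' : ∀ x, ENNReal.ofReal (‖f x‖ ^ p * powerWeight α k₀ k x) = v x * ‖f x‖ₑ ^ p := fun x => by
    rw [mul_comm, hv]
  have hvm : Measurable fun z : Fin d → ℝ => v (WithLp.toLp 2 z) :=
    ((measurable_powerWeight α k₀ k).ennreal_ofReal).comp (by fun_prop)
  have hfm : Measurable fun z : Fin d → ℝ => ‖f (WithLp.toLp 2 z)‖ₑ ^ p :=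
    hfs.continuous.measurable.enorm.pow_const p
  have hdm : ∀ c : Fin d → ℝ, Measurable fun z : Fin d → ℝ => ∏ i, decay 2 (c i - z i) := fun c =>
    Finset.measurable_fun_prod _ fun i _ => (measurable_decay 2).comp (by fun_prop)
  simp only [hv, hv']
  rw [EuclideanSpace.lintegral_eq_lintegral_pi]
  constructor
  · set E : Set (Fin d → ℝ) := {z | ∀ j, δ' ≤ |∑ l, β j l * z l|}
    have hE : ∀ z ∈ E, δ' ≤ ‖WithLp.toLp 2 z‖ ∧ ∀ j, δ' ≤ |inner ℝ (α j) (WithLp.toLp 2 z)| := by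
      intro z hz
      constructor
      · have h0 := hz none
        have e : ∑ l, β none l * z l = z ⟨0, hd⟩ := by simp [β, Pi.single_apply]
        rw [e] at h0
        exact h0.trans (PiLp.norm_apply_le (WithLp.toLp 2 z) ⟨0, hd⟩)
      · intro j
        have h0 := hz (some j)
        have e : ∑ l, β (some j) l * z l = inner ℝ (α j) (WithLp.toLp 2 z) := by
          simp [β, PiLp.inner_apply, mul_comm]
        rwa [e] at h0
    have hEm : MeasurableSet E := by
      have e : E = ⋂ j, {z | δ' ≤ |∑ l, β j l * z l|} := by ext z; simp [E]
      rw [e]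
      exact MeasurableSet.iInter fun j => measurableSet_le measurable_const (by fun_prop)
    have hcount : ∀ z : Fin d → ℝ, ∑' n, ∏ i, decay 2 (lam n i - z i) ≤ (∏ i, S i : ℝ≥0) := by
      intro z
      rw [← lintegral_pi_count]
      refine lintegral_prod_le_of_step (w := fun i n => decay 2 (lam n i - z i))
        (fun i => Measurable.of_discrete) (fun i n n' hnn => by rw [hlam1.depends i n n' hnn])
        fun i n => ?_
      rw [MeasureTheory.lintegral_count]
      exact HS i (fun k => lam (Function.update n i k) i)
        (fun k => by simpa using hs.near (Function.update n i k) i) _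
    calc ∑' n, v (lam n) * ‖f (lam n)‖ₑ ^ p
        ≤ ∑' n, (D₁ * W₁ : ℝ≥0) * ∫⁻ z in E, v (WithLp.toLp 2 z) * ‖f (WithLp.toLp 2 z)‖ₑ ^ p *
            ∏ i, decay 2 (lam n i - z i) := by
          refine ENNReal.tsum_le_tsum fun n => ?_
          have h1 := H₁ _ hfs (lam n).ofLp
          calc v (lam n) * ‖f (lam n)‖ₑ ^ p
              ≤ v (lam n) * (D₁ * ∫⁻ z in E, ‖f (WithLp.toLp 2 z)‖ₑ ^ p *
                  ∏ i, decay r (lam n i - z i)) := mul_le_mul' le_rfl h1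
            _ = D₁ * ∫⁻ z in E, v (lam n) * (‖f (WithLp.toLp 2 z)‖ₑ ^ p *
                  ∏ i, decay r (lam n i - z i)) := by
                rw [MeasureTheory.lintegral_const_mul' _ _ ENNReal.ofReal_ne_top]; ring
            _ ≤ D₁ * ∫⁻ z in E, W₁ * (v (WithLp.toLp 2 z) * ‖f (WithLp.toLp 2 z)‖ₑ ^ p *
                  ∏ i, decay 2 (lam n i - z i)) := by
                refine mul_le_mul' le_rfl ?_
                refine MeasureTheory.setLIntegral_mono' hEm fun z hz => ?_
                have h2 := HW₁ (lam n) (WithLp.toLp 2 z) (hE z hz).1 (hE z hz).2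
                calc _ = ‖f (WithLp.toLp 2 z)‖ₑ ^ p *
                      (v (lam n) * ∏ i, decay r (lam n i - z i)) := by ring
                  _ ≤ ‖f (WithLp.toLp 2 z)‖ₑ ^ p * (W₁ * (v (WithLp.toLp 2 z) *
                      ∏ i, decay 2 (lam n i - z i))) := mul_le_mul' le_rfl h2
                  _ = _ := by ring
            _ = _ := by
                rw [MeasureTheory.lintegral_const_mul' _ _ ENNReal.coe_ne_top, ENNReal.coe_mul,
                  mul_assoc]
      _ = (D₁ * W₁ : ℝ≥0) * ∫⁻ z in E, v (WithLp.toLp 2 z) * ‖f (WithLp.toLp 2 z)‖ₑ ^ p *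
            ∑' n, ∏ i, decay 2 (lam n i - z i) := by
          have hm : ∀ n, Measurable fun z : Fin d → ℝ => v (WithLp.toLp 2 z) *
              ‖f (WithLp.toLp 2 z)‖ₑ ^ p * ∏ i, decay 2 (lam n i - z i) := fun n =>
            (hvm.mul hfm).mul (hdm (lam n).ofLp)
          rw [ENNReal.tsum_mul_left, ← MeasureTheory.lintegral_tsum fun n => (hm n).aemeasurable]
          simp only [ENNReal.tsum_mul_left]
      _ ≤ (D₁ * W₁ : ℝ≥0) * ∫⁻ z in E, v (WithLp.toLp 2 z) * ‖f (WithLp.toLp 2 z)‖ₑ ^ p *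
            (∏ i, S i : ℝ≥0) := by
          gcongr with z
          exact hcount z
      _ ≤ (D₁ * W₁ : ℝ≥0) * ∫⁻ z, v (WithLp.toLp 2 z) * ‖f (WithLp.toLp 2 z)‖ₑ ^ p *
            (∏ i, S i : ℝ≥0) := by
          gcongr
          exact MeasureTheory.Measure.restrict_le_self
      _ = (D₁ * W₁ * (∏ i, S i) : ℝ≥0) *
            ∫⁻ z, v (WithLp.toLp 2 z) * ‖f (WithLp.toLp 2 z)‖ₑ ^ p := by
          rw [MeasureTheory.lintegral_mul_const' _ _ ENNReal.coe_ne_top, ENNReal.coe_mul (D₁ * W₁),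
            mul_assoc, mul_comm (∫⁻ z, _)]
      _ ≤ _ := by
          gcongr
          exact le_self_add
  · have hint : ∀ c : Fin d → ℝ, ∫⁻ z : Fin d → ℝ, ∏ i, decay 2 (z i - c i) ≤
        (∏ _i : Fin d, I : ℝ≥0) := by
      intro c
      rw [MeasureTheory.volume_pi]
      refine lintegral_prod_le_of_step (w := fun i z => decay 2 (z i - c i))
        (fun i => (measurable_decay 2).comp (by fun_prop))
        (fun i n n' hnn => by rw [hnn i le_rfl]) fun i n => ?_
      simpa using hI (c i)
    calc ∫⁻ z, v (WithLp.toLp 2 z) * ‖f (WithLp.toLp 2 z)‖ₑ ^ p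
        ≤ ∫⁻ z : Fin d → ℝ, (D₂ * W₂ : ℝ≥0) * ∑' n, v (lam n) * ‖f (lam n)‖ₑ ^ p *
            ∏ i, decay 2 (z i - lam n i) := by
          refine MeasureTheory.lintegral_mono fun z => ?_
          have h1 := H₂ _ hs _ hfs z
          calc v (WithLp.toLp 2 z) * ‖f (WithLp.toLp 2 z)‖ₑ ^ p
              ≤ v (WithLp.toLp 2 z) * (D₂ * ∑' n, ‖f (lam n)‖ₑ ^ p *
                  ∏ i, decay r (z i - lam n i)) := mul_le_mul' le_rfl h1
            _ = D₂ * ∑' n, v (WithLp.toLp 2 z) * (‖f (lam n)‖ₑ ^ p *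
                  ∏ i, decay r (z i - lam n i)) := by rw [ENNReal.tsum_mul_left]; ring
            _ ≤ D₂ * ∑' n, W₂ * (v (lam n) * ‖f (lam n)‖ₑ ^ p *
                  ∏ i, decay 2 (z i - lam n i)) := by
                refine mul_le_mul' le_rfl (ENNReal.tsum_le_tsum fun n => ?_)
                have h2 := HW₂ (WithLp.toLp 2 z) (lam n) (hlam4 n).1 (hlam4 n).2
                calc _ = ‖f (lam n)‖ₑ ^ p *
                      (v (WithLp.toLp 2 z) * ∏ i, decay r (z i - lam n i)) := by ring
                  _ ≤ ‖f (lam n)‖ₑ ^ p * (W₂ * (v (lam n) *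
                      ∏ i, decay 2 (z i - lam n i))) := mul_le_mul' le_rfl h2
                  _ = _ := by ring
            _ = _ := by rw [ENNReal.tsum_mul_left, ENNReal.coe_mul, mul_assoc]
      _ = (D₂ * W₂ : ℝ≥0) * ∑' n, v (lam n) * ‖f (lam n)‖ₑ ^ p *
            ∫⁻ z : Fin d → ℝ, ∏ i, decay 2 (z i - lam n i) := by
          have hm : ∀ n, Measurable fun z : Fin d → ℝ => ∏ i, decay 2 (z i - lam n i) := fun n =>
            Finset.measurable_fun_prod _ fun i _ => (measurable_decay 2).comp (by fun_prop)
          rw [MeasureTheory.lintegral_const_mul' _ _ ENNReal.coe_ne_top,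
            MeasureTheory.lintegral_tsum fun n => ((hm n).const_mul _).aemeasurable]
          congr 1
          exact tsum_congr fun n => MeasureTheory.lintegral_const_mul _ (hm n)
      _ ≤ (D₂ * W₂ : ℝ≥0) * ∑' n, v (lam n) * ‖f (lam n)‖ₑ ^ p * (∏ _i : Fin d, I : ℝ≥0) := by
          gcongr with n
          exact hint _
      _ = (D₂ * W₂ * (∏ _i : Fin d, I) : ℝ≥0) * ∑' n, v (lam n) * ‖f (lam n)‖ₑ ^ p := by
          rw [ENNReal.tsum_mul_right, ENNReal.coe_mul (D₂ * W₂), mul_assoc, mul_comm (∑' n, _)]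
      _ ≤ _ := by
          gcongr
          exact le_self_add
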